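/- **Setting.** Let $d\ge 1$, let $\|\cdot\|$ be the Euclidean norm and $\|\cdot\|_1$ the $\ell_1$-norm on $\mathbb R^d$, and let $1\le s\le d$. Let $(\pi_\theta)_{\theta\in\mathbb R^d}$ be a parametrized autoregressive language model: for tokens from a vocabulary, $\pi_\theta(\mathbf y\mid\mathbf x)=\prod_{k=1}^{|\mathbf y|}\pi_\theta(\mathbf y_k\mid\mathbf x,\mathbf y_{<k})$. Let $\mathcal D$ be a set of samples $(\mathbf x,\mathbf y^+,\mathbf y^-)$ (prompt, preferred and dispreferred response). The preference comparison oracle $\mathcal C_\pi(\theta,\theta')$ returns $-1$ if $\pi_{\theta'}(\mathbf y^+\mid\mathbf x)>\pi_\theta(\mathbf y^+\mid\mathbf x)$ and $\pi_{\theta'}(\mathbf y^-\mid\mathbf x)<\pi_\theta(\mathbf y^-\mid\mathbf x)$ for all $(\mathbf x,\mathbf y^+,\mathbf y^-)\in\mathcal D$, and $+1$ otherwise. **Algorithm.** Given $\theta_1\in\mathbb R^d$, $\eta>0$, $r>0$ and integers $m,T\ge1$, do for $t=1,\dots,T$: draw $\mathbf z_1,\dots,\mathbf z_m$ independently (also of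 the earlier iterations) and uniformly from the unit sphere of $\mathbb R^d$; query $y_i=\mathcal C_\pi(\theta_t,\theta_t+r\mathbf z_i)$ for $i=1,\dots,m$; let $\hat{\mathbf g}_t$ be a maximizer of $\sum_{i=1}^m y_i\mathbf z_i^\top\mathbf g$ over $\{\mathbf g:\|\mathbf g\|_1\le\sqrt s,\ \|\mathbf g\|\le1\}$, chosen by an arbitrary fixed measurable rule applied to $(\mathbf z_i,y_i)_{i\le m}$; set $\theta_{t+1}=\theta_t-\eta\hat{\mathbf g}_t$. **Theorem.** There are absolute constants $c_m,C>0$ such that the following holds for all $d,s,\pi,\mathcal D$ as above. Let $f:\mathbb R^d\to\mathbb R$ be a (possibly nonconvex) differentiable function that is bounded below and $\ell$-smooth, i.e. $\|\nabla f(\theta)-\nabla f(\theta')\|\le\ell\|\theta-\theta'\|$ for all $\theta,\theta'$, where $\ell>0$. Suppose that (i) for all $\theta,\theta'$: $f(\theta')<f(\theta)$ if and only if $\pi_{\theta'}(\mathbf y^+\mid\mathbf x)>\pi_\theta(\mathbf y^+\mid\mathbf x)$ and $\pi_{\theta'}(\mathbf y^-\mid\mathbf x)<\pi_\theta(\mathbf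 y^-\mid\mathbf x)$ for all $(\mathbf x,\mathbf y^+,\mathbf y^-)\in\mathcal D$; (ii) $\|\nabla f(\theta)\|_1\le\sqrt s\,\|\nabla f(\theta)\|$ for all $\theta$. Let $\theta_1\in\mathbb R^d$, let $\Delta>0$ satisfy $f(\theta_1)-\inf_\theta f(\theta)\le\Delta$, and let $\epsilon,\Lambda\in(0,1)$. Put $$T=\Big\lceil \frac{10\,\ell\Delta}{\epsilon^2}\Big\rceil,\quad \eta=\sqrt{\frac{2\Delta}{\ell T}},\quad r=\frac{\epsilon}{40\,\ell\sqrt d},\quad m=\max\Big\{1,\Big\lceil c_m\Big(s\log\frac{2d}{s}+\log\frac{\ell\Delta}{\Lambda\epsilon^2}\Big)\Big\rceil\Big\}.$$ Then the iterates of the algorithm satisfy $$\mathbb P\Big(\min_{1\le t\le T}\|\nabla f(\theta_t)\|<\epsilon\Big)>1-\Lambda ,$$ the total number of oracle calls is $mT$, and, whenever $\epsilon^2\le\ell\Delta$, it is at most $$C\,\frac{\ell\Delta}{\epsilon^2}\Big(s\log\frac{2d}{s}+\log\frac{\ell\Delta}{\Lambda\epsilon^2}\Big).$$ -/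

import Mathlib

open MeasureTheory ProbabilityTheory
open scoped ENNReal

namespace ComPO

/-- The parameter space `ℝᵈ` with its Euclidean norm. -/
abbrev Param (d : ℕ) : Type := EuclideanSpace ℝ (Fin d)

/-- The `ℓ₁` norm on `ℝᵈ`. -/
def l1Norm {d : ℕ} (g : Param d) : ℝ := ∑ i, |g i|

/-- `f` is `ℓ`-smooth: differentiable, with `ℓ`-Lipschitz gradient. -/
def IsSmoothWith {d : ℕ} (l : ℝ) (f : Param d → ℝ) : Prop :=
  Differentiable ℝ f ∧ ∀ θ θ' : Param d, ‖gradient f θ - gradient f θ'‖ ≤ l * ‖θ - θ'‖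

/-- The uniform probability distribution on the unit sphere of `ℝᵈ` (normalized surface measure),
as a measure on `ℝᵈ`. -/
noncomputable def uniformSphere (d : ℕ) : Measure (Param d) :=
  (((volume : Measure (Param d)).toSphere Set.univ)⁻¹ •
    (volume : Measure (Param d)).toSphere).map Subtype.val

/-! ### Language models and preference data -/

/-- A parametrized autoregressive language model over the vocabulary `V`: for every parameter, a
prompt and a sequence of already generated tokens give the distribution of the next token. -/
abbrev Policy (d : ℕ) (V : Type*) : Type _ := Param d → List V → List V → PMF V

/-- `π_θ(y | x) = ∏ₖ π_θ(yₖ | x, y_{<k})`. -/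
noncomputable def Policy.likelihood {d : ℕ} {V : Type*} (p : Policy d V) (θ : Param d)
    (x y : List V) : ℝ≥0∞ :=
  ∏ k : Fin y.length, p θ x (y.take k) (y.get k)

/-- A sample `(x, y⁺, y⁻)` of pairwise preference data. -/
structure PrefSample (V : Type*) where
  prompt : List V
  preferred : List V
  dispreferred : List V

/-- On every sample of the dataset, `π_θ'` gives a higher likelihood to the preferred response
and a lower likelihood to the dispreferred response than `π_θ`. -/
def Improves {d : ℕ} {V : Type*} (p : Policy d V) (D : Set (PrefSample V))
    (θ θ' : Param d) : Prop :=
  ∀ q ∈ D,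
    p.likelihood θ' q.prompt q.preferred > p.likelihood θ q.prompt q.preferred ∧
    p.likelihood θ' q.prompt q.dispreferred < p.likelihood θ q.prompt q.dispreferred

open Classical in
/-- The preference comparison oracle `C_π(θ, θ') ∈ {+1, -1}`; a query is a pair `(θ, θ')`. -/
noncomputable def prefOracle {d : ℕ} {V : Type*} (p : Policy d V) (D : Set (PrefSample V))
    (q : Param d × Param d) : ℝ :=
  if Improves p D q.1 q.2 then -1 else 1

/-! ### Computations with an oracle -/

/-- Computations that may query an oracle (queries in `Q`, answers in `A`) and return an `α`. -/
inductive OracleComp (Q : Type*) (A : Type*) (α : Type*) where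
  | done (a : α) : OracleComp Q A α
  | ask (q : Q) (k : A → OracleComp Q A α) : OracleComp Q A α

/-- Sequential composition. -/
def OracleComp.bind {Q A α β : Type*} : OracleComp Q A α → (α → OracleComp Q A β) →
    OracleComp Q A β
  | .done a, f => f a
  | .ask q k, f => .ask q fun a => (k a).bind f

/-- Execution against a given oracle: the returned value and the number of oracle calls. -/
def OracleComp.run {Q A α : Type*} (O : Q → A) : OracleComp Q A α → α × ℕ
  | .done a => (a, 0)
  | .ask q k => (((k (O q)).run O).1, ((k (O q)).run O).2 + 1)

/-- Ask `m` queries and collect the answers. -/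
def askAll {Q A : Type*} : (m : ℕ) → (Fin m → Q) → OracleComp Q A (Fin m → A)
  | 0, _ => .done Fin.elim0
  | m + 1, q => .ask (q 0) fun a => (askAll m fun i => q i.succ).bind fun y => .done (Fin.cons a y)

/-! ### The algorithm -/

/-- The constraint set `{g : ‖g‖₁ ≤ √s, ‖g‖ ≤ 1}`. -/
def feasible (d : ℕ) (s : ℝ) : Set (Param d) := {g | l1Norm g ≤ √s ∧ ‖g‖ ≤ 1}

/-- `solver z y` is a maximizer of `g ↦ ∑ᵢ yᵢ zᵢᵀ g` over the constraint set, for all `z`, `y`. -/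
def IsArgmaxSolver {d m : ℕ} (s : ℝ) (solver : (Fin m → Param d) → (Fin m → ℝ) → Param d) : Prop :=
  ∀ z y, solver z y ∈ feasible d s ∧
    IsMaxOn (fun g => ∑ i, y i * inner ℝ (z i) g) (feasible d s) (solver z y)

/-- One iteration, from `θ` and with perturbations `z`: query the oracle at `(θ, θ + r zᵢ)` for all
`i`, compute the 1-bit gradient estimate and take a step of size `η` against it. -/
def step {d m : ℕ} (r η : ℝ) (solver : (Fin m → Param d) → (Fin m → ℝ) → Param d)
    (θ : Param d) (z : Fin m → Param d) : OracleComp (Param d × Param d) ℝ (Param d) :=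
  (askAll m fun i => (θ, θ + r • z i)).bind fun y => .done (θ - η • solver z y)

/-- `T` iterations from `θ₁ = θ`, where `z t` are the perturbations of iteration number `t + 1`. The
returned value is `(θ₁, …, θ_{T+1})`. -/
def basicScheme {d m : ℕ} (r η : ℝ) (solver : (Fin m → Param d) → (Fin m → ℝ) → Param d) :
    (T : ℕ) → Param d → (Fin T → Fin m → Param d) →
      OracleComp (Param d × Param d) ℝ (Fin (T + 1) → Param d)
  | 0, θ, _ => .done fun _ => θ
  | T + 1, θ, z => (step r η solver θ (z 0)).bind fun θ' =>
      (basicScheme r η solver T θ' fun t => z t.succ).bind fun θs => .done (Fin.cons θ θs)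

end ComPO

/-! Let `g` be the normalized gradient at a point where the gradient has norm at least `ε`. By
smoothness and the choice of `r`, the oracle's answer at `θ + r z` is the sign of `⟨g, z⟩` except in
a strip of width of order `1/√d` (`IsSmoothWith.agreesOffStrip`). So `y(z) z` is a one-bit
measurement of `g`: its mean is close to `λ g` with `λ = E|⟨g, z⟩| ≥ 0.797/√d`, and the strip costs
only a smaller multiple of `1/√d` (`integral_mul_inner_le`, `le_integral_mul_inner`).

The average of `m` measurements deviates from its mean by at most `0.025/√d`, uniformly over the
constraint set, with probability `1 - q` once `m` is of order `s log(2d/s) + log(1/q)`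
(`measure_deviation_le`). No net or chaining is used. The exponential moment of `∏ⱼ (1 + (s/d) exp(a
wⱼ²))` is bounded for the deviation `w`, and a bound on this product controls `⟨w, h⟩` for all
feasible `h` at once: coordinates below a threshold are paid by the `ℓ₁` norm of `h`, the excess by
its Euclidean norm. Hence a maximizer has inner product at least `1/2` with `g`, which is itself
feasible by the sparsity hypothesis (`measure_not_correlated_le`).

The perturbations of an iteration are independent of the current iterate, so a union bound with `q =
Λ/(2T)` makes all steps from points of large gradient good simultaneously (`measure_orbit_le`). If
all gradients stayed above `ε`, the descent inequality would push `f` below its infimum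
(`IsSmoothWith.exists_norm_gradient_lt`).

Moments and exponential moments on the sphere come from the Gaussian, whose direction and length are
independent. -/

namespace ComPO

/-! ### Polar decomposition of the standard Gaussian -/

variable {d : ℕ}

/-- The density of the standard Gaussian at distance `r` from the origin of `ℝᵈ`. -/
noncomputable def radialGaussian (d : ℕ) (r : ℝ) : ℝ :=
  (2 * Real.pi) ^ (-(d / 2 : ℝ)) * Real.exp (-(1 / 2) * r ^ 2)

lemma radialGaussian_nonneg (d : ℕ) (r : ℝ) : 0 ≤ radialGaussian d r := by
  unfold radialGaussian; positivity

lemma measurable_radialGaussian (d : ℕ) : Measurable (radialGaussian d) := by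
  unfold radialGaussian; fun_prop

lemma stdGaussian_eq_withDensity (d : ℕ) :
    stdGaussian (Param d) =
      (volume : Measure (Param d)).withDensity fun x => ENNReal.ofReal (radialGaussian d ‖x‖) := by
  have hint : Integrable (fun x : Param d => radialGaussian d ‖x‖) := by
    have h := GaussianFourier.integrable_cexp_neg_mul_sq_norm_add (V := Param d) (b := 1 / 2)
      (by norm_num) 0 0
    have h2 := h.norm.const_mul ((2 * Real.pi) ^ (-(d / 2 : ℝ)))
    refine h2.congr (.of_forall fun x => ?_)
    simp only [radialGaussian, Complex.norm_exp]
    congr 2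
    have : (-(1 / 2 : ℂ) * (‖x‖ : ℂ) ^ 2 + 0 * ((inner ℝ (0 : Param d) x : ℝ) : ℂ))
      = ((-(1 / 2) * ‖x‖ ^ 2 : ℝ) : ℂ) := by push_cast; ring
    rw [this, Complex.ofReal_re]
  have : IsFiniteMeasure ((volume : Measure (Param d)).withDensity
      fun x => ENNReal.ofReal (radialGaussian d ‖x‖)) :=
    isFiniteMeasure_withDensity_ofReal hint.2
  apply Measure.ext_of_charFun
  ext t
  rw [charFun_stdGaussian, charFun_apply,
    integral_withDensity_eq_integral_toReal_smul (by
      have := measurable_radialGaussian d; fun_prop) (by simp)]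
  have h := GaussianFourier.integral_cexp_neg_mul_sq_norm_add (V := Param d) (b := 1 / 2)
      (by norm_num) Complex.I t
  have e : ∀ x : Param d, (ENNReal.ofReal (radialGaussian d ‖x‖)).toReal •
      Complex.exp (inner ℝ x t * Complex.I) = ((2 * Real.pi) ^ (-(d / 2 : ℝ)) : ℝ) *
        Complex.exp (-(1 / 2 : ℂ) * (‖x‖ : ℂ) ^ 2 + Complex.I * (inner ℝ t x : ℝ)) := by
    intro x
    rw [ENNReal.toReal_ofReal (radialGaussian_nonneg _ _), radialGaussian, Complex.exp_add,
      Complex.real_smul, real_inner_comm]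
    push_cast
    rw [mul_assoc, mul_comm Complex.I]
  simp_rw [e]
  rw [integral_const_mul, h]
  have hpi : (Real.pi / (1 / 2) : ℂ) = ((2 * Real.pi : ℝ) : ℂ) := by push_cast; ring
  rw [hpi, finrank_euclideanSpace, Fintype.card_fin]
  have : ((d : ℂ) / 2) = ((d / 2 : ℝ) : ℂ) := by push_cast; ring
  rw [this, ← Complex.ofReal_cpow (by positivity), ← mul_assoc, ← Complex.ofReal_mul,
    ← Real.rpow_add (by positivity)]
  simp only [neg_add_cancel, Real.rpow_zero, Complex.ofReal_one, one_mul]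
  congr 1
  rw [Complex.I_sq]; ring

lemma isProbabilityMeasure_uniformSphere {d : ℕ} (hd : 0 < d) :
    IsProbabilityMeasure (uniformSphere d) := by
  have : Nonempty (Fin d) := ⟨⟨0, hd⟩⟩
  have : Nontrivial (Param d) := inferInstance
  unfold uniformSphere
  refine @Measure.isProbabilityMeasure_map _ _ _ _ _ ?_ _ (by fun_prop)
  refine ⟨?_⟩
  rw [Measure.smul_apply, smul_eq_mul]
  refine ENNReal.inv_mul_cancel ?_ (measure_ne_top _ _)
  rw [Ne, Measure.measure_univ_eq_zero]
  exact Measure.toSphere_ne_zero _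

lemma ae_norm_uniformSphere (d : ℕ) : ∀ᵐ z ∂uniformSphere d, ‖z‖ = 1 := by
  unfold uniformSphere
  rw [ae_map_iff (by fun_prop) (by measurability)]
  exact .of_forall fun z => by simp

lemma exists_stdGaussian_eq_map_prod {d : ℕ} (hd : 0 < d) :
    ∃ ρ : Measure ℝ, IsProbabilityMeasure ρ ∧ (∀ᵐ r ∂ρ, 0 < r) ∧
      stdGaussian (Param d) = ((uniformSphere d).prod ρ).map fun p => p.2 • p.1 := by
  have : Nonempty (Fin d) := ⟨⟨0, hd⟩⟩
  have : Nontrivial (Param d) := inferInstance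
  set σ := (volume : Measure (Param d)).toSphere with hσ
  set ν := Measure.volumeIoiPow (Module.finrank ℝ (Param d) - 1) with hν
  set c := σ Set.univ with hc
  have hc0 : c ≠ 0 := by
    rw [hc, Ne, Measure.measure_univ_eq_zero]; exact Measure.toSphere_ne_zero _
  have hct : c ≠ ∞ := measure_ne_top _ _
  set φ : Set.Ioi (0 : ℝ) → ℝ≥0∞ := fun r => ENNReal.ofReal (radialGaussian d r.1) with hφ
  have hφm : Measurable φ := by have := measurable_radialGaussian d; fun_prop
  -- The factor `c`, the total surface measure, compensates the normalization of `uniformSphere`.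
  set ρ : Measure ℝ := c • (ν.withDensity φ).map Subtype.val with hρ
  have hsf : SFinite ρ := by rw [hρ]; infer_instance
  have hP := isProbabilityMeasure_uniformSphere hd
  have hm : Measurable fun p : Param d × ℝ => p.2 • p.1 := by fun_prop
  have key : stdGaussian (Param d) = ((uniformSphere d).prod ρ).map fun p => p.2 • p.1 := by
    refine Measure.ext_of_lintegral _ fun F hF => ?_
    rw [lintegral_map hF hm, lintegral_prod _ (by fun_prop), stdGaussian_eq_withDensity,
      lintegral_withDensity_eq_lintegral_mul _ (by
        have := measurable_radialGaussian d; fun_prop) hF]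
    have h1 : ∀ G : Param d → ℝ≥0∞, Measurable G →
        ∫⁻ x, G x = ∫⁻ z, ∫⁻ r, G (r.1 • z.1) ∂ν ∂σ := by
      intro G hG
      rw [← lintegral_prod (fun p : Metric.sphere (0 : Param d) 1 × Set.Ioi (0 : ℝ) =>
        G (p.2.1 • p.1.1)) (by fun_prop)]
      have := (Measure.measurePreserving_homeomorphUnitSphereProd
        (volume : Measure (Param d))).lintegral_comp_emb (Homeomorph.measurableEmbedding _)
        (fun p : Metric.sphere (0 : Param d) 1 × Set.Ioi (0 : ℝ) => G (p.2.1 • p.1.1))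
      rw [← this]
      conv_lhs => rw [← restrict_compl_singleton (μ := (volume : Measure (Param d))) 0]
      rw [← lintegral_subtype_comap (measurableSet_singleton _).compl]
      refine lintegral_congr fun x => ?_
      congr 1
      exact (congrArg Subtype.val
        ((homeomorphUnitSphereProd (Param d)).symm_apply_apply x)).symm
    rw [h1 _ (by
      have := measurable_radialGaussian d
      exact (by fun_prop : Measurable fun x : Param d => ENNReal.ofReal (radialGaussian d ‖x‖)).mul
        hF)]
    rw [uniformSphere, lintegral_map (Measurable.lintegral_prod_right' (f := fun p : Param d × ℝ =>
      F (p.2 • p.1)) (by fun_prop)) (by fun_prop), lintegral_smul_measure, smul_eq_mul]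
    rw [← lintegral_const_mul _ (Measurable.lintegral_prod_right' (f := fun p : Metric.sphere (0 : Param d) 1 × ℝ =>
      F (p.2 • p.1.1)) (by fun_prop))]
    refine lintegral_congr fun z => ?_
    rw [hρ, lintegral_smul_measure, smul_eq_mul, ← mul_assoc, ENNReal.inv_mul_cancel hc0 hct,
      one_mul, lintegral_map (by fun_prop) (by fun_prop),
      lintegral_withDensity_eq_lintegral_mul _ hφm (by fun_prop)]
    refine lintegral_congr fun r => ?_
    simp only [Pi.mul_apply, hφ]
    rw [norm_smul, Real.norm_of_nonneg r.2.out.le]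
    simp
  refine ⟨ρ, ⟨?_⟩, ?_, key⟩
  · have h := congrArg (fun μ : Measure (Param d) => μ Set.univ) key
    simp only [measure_univ] at h
    rw [Measure.map_apply hm .univ, Set.preimage_univ, ← Set.univ_prod_univ,
      Measure.prod_prod, measure_univ, one_mul] at h
    exact h.symm
  · rw [hρ]
    refine Measure.ae_smul_measure ?_ _
    rw [ae_map_iff (by fun_prop) measurableSet_Ioi]
    exact .of_forall fun r => r.2

/-! ### Gaussian computations -/

lemma integral_abs_gaussianReal : ∫ x, |x| ∂gaussianReal 0 1 = √(2 / Real.pi) := by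
  rw [integral_gaussianReal_eq_integral_smul one_ne_zero]
  have h := integral_comp_abs (f := fun x => x * Real.exp (-(1 / 2) * x ^ 2))
  have h2 := integral_rpow_mul_exp_neg_mul_rpow (p := 2) (q := 1) (b := 1 / 2)
    (by norm_num) (by norm_num) (by norm_num)
  simp only [Real.rpow_one, Real.rpow_ofNat] at h2
  rw [h2] at h
  have e : ∀ x : ℝ, gaussianPDFReal 0 1 x • |x| =
      (√(2 * Real.pi))⁻¹ * (|x| * Real.exp (-(1 / 2) * |x| ^ 2)) := by
    intro x
    simp only [gaussianPDFReal, NNReal.coe_one, mul_one, sub_zero, smul_eq_mul, sq_abs]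
    rw [show -x ^ 2 / 2 = -(1 / 2) * x ^ 2 by ring]; ring
  simp_rw [e]
  rw [integral_const_mul, h]
  norm_num
  rw [mul_assoc, ← div_eq_inv_mul, div_eq_div_iff (by positivity) (by positivity)]
  field_simp
  rw [Real.sq_sqrt (by norm_num)]

lemma gaussianReal_Icc_le {a : ℝ} (ha : 0 ≤ a) :
    (gaussianReal 0 1).real (Set.Icc (-a) a) ≤ 0.8 * a := by
  have h : gaussianReal 0 1 (Set.Icc (-a) a) ≤ ENNReal.ofReal (0.8 * a) := by
    rw [gaussianReal_apply _ one_ne_zero]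
    calc ∫⁻ x in Set.Icc (-a) a, gaussianPDF 0 1 x
        ≤ ∫⁻ _ in Set.Icc (-a) a, ENNReal.ofReal 0.4 := by
          refine lintegral_mono fun x => ?_
          refine ENNReal.ofReal_le_ofReal ?_
          simp only [gaussianPDFReal, NNReal.coe_one, mul_one, sub_zero]
          have h1 : Real.exp (-x ^ 2 / 2) ≤ 1 := Real.exp_le_one_iff.2 (by nlinarith [sq_nonneg x])
          have h2 : (√(2 * Real.pi))⁻¹ ≤ 0.4 := by
            rw [inv_le_comm₀ (by positivity) (by norm_num)]
            refine Real.le_sqrt_of_sq_le ?_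
            have := Real.pi_gt_d6
            norm_num at *; linarith
          calc _ ≤ 0.4 * (1 : ℝ) := by gcongr
            _ = _ := by norm_num
      _ = ENNReal.ofReal (0.8 * a) := by
          rw [setLIntegral_const, Real.volume_Icc, ← ENNReal.ofReal_mul (by norm_num)]
          congr 1; ring
  exact ENNReal.toReal_le_of_le_ofReal (by positivity) h

lemma map_inner_stdGaussian (v : Param d) :
    (stdGaussian (Param d)).map (fun x => inner ℝ v x) = gaussianReal 0 (‖v‖₊ ^ 2) := by
  have h := IsGaussian.map_eq_gaussianReal (μ := stdGaussian (Param d)) (innerSL ℝ v)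
  rw [integral_strongDual_stdGaussian, variance_dual_stdGaussian, innerSL_apply_norm] at h
  convert! h
  ext; simp

lemma integrable_norm_pow_stdGaussian (k : ℕ) :
    Integrable (fun x => ‖x‖ ^ k) (stdGaussian (Param d)) := by
  rcases Nat.eq_zero_or_pos k with rfl | hk
  · simp
  · have := (IsGaussian.memLp_id (stdGaussian (Param d)) k (by simp)).integrable_norm_pow hk.ne'
    simpa using this

lemma integral_abs_inner_stdGaussian {v : Param d} (hv : ‖v‖ = 1) :
    ∫ x, |inner ℝ v x| ∂stdGaussian (Param d) = √(2 / Real.pi) := by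
  rw [← integral_abs_gaussianReal]
  have h := map_inner_stdGaussian v
  have : ‖v‖₊ = 1 := by ext; simpa using hv
  rw [this, one_pow] at h
  rw [← h, integral_map (by fun_prop) (by fun_prop)]

lemma integral_inner_sq_stdGaussian (v : Param d) :
    ∫ x, inner ℝ v x ^ 2 ∂stdGaussian (Param d) = ‖v‖ ^ 2 := by
  have h := variance_dual_stdGaussian (E := Param d) (innerSL ℝ v)
  rw [variance_eq_integral (by fun_prop), integral_strongDual_stdGaussian, innerSL_apply_norm] at h
  simpa using h

lemma integrable_exp_inner_stdGaussian (v : Param d) :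
    Integrable (fun x => Real.exp (inner ℝ v x)) (stdGaussian (Param d)) := by
  have h := integrable_exp_mul_gaussianReal (μ := 0) (v := ‖v‖₊ ^ 2) 1
  rw [← map_inner_stdGaussian v, integrable_map_measure (by fun_prop) (by fun_prop)] at h
  simpa [Function.comp_def] using h

lemma integral_exp_inner_stdGaussian (v : Param d) :
    ∫ x, Real.exp (inner ℝ v x) ∂stdGaussian (Param d) = Real.exp (‖v‖ ^ 2 / 2) := by
  have h := mgf_gaussianReal (map_inner_stdGaussian v) 1
  simpa [mgf] using h

lemma integral_norm_sq_stdGaussian : ∫ x, ‖x‖ ^ 2 ∂stdGaussian (Param d) = d := by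
  have : ∀ x : Param d, ‖x‖ ^ 2 = ∑ j, inner ℝ (EuclideanSpace.single j (1 : ℝ)) x ^ 2 := by
    intro x; simp [EuclideanSpace.real_norm_sq_eq, EuclideanSpace.inner_single_left]
  simp_rw [this]
  rw [integral_finsetSum]
  · simp_rw [integral_inner_sq_stdGaussian]; simp
  · intro j _
    exact (IsGaussian.memLp_dual (stdGaussian (Param d))
      (innerSL ℝ (EuclideanSpace.single j (1 : ℝ))) 2 (by simp)).integrable_sq

/-- AM-GM, `2 √d ‖x‖ ≤ ‖x‖² + d`, reduces the first moment to the second. -/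
lemma integral_norm_stdGaussian_le : ∫ x, ‖x‖ ∂stdGaussian (Param d) ≤ √d := by
  rcases Nat.eq_zero_or_pos d with rfl | hd
  · have : ∀ x : Param 0, x = 0 := fun x => Subsingleton.elim _ _
    simp [this]
  have hs : 0 < √(d : ℝ) := by positivity
  have h1 := integrable_norm_pow_stdGaussian (d := d) 1
  have h2 := integrable_norm_pow_stdGaussian (d := d) 2
  simp only [pow_one] at h1
  calc ∫ x, ‖x‖ ∂stdGaussian (Param d)
      ≤ ∫ x, (2 * √d)⁻¹ * (‖x‖ ^ 2 + d) ∂stdGaussian (Param d) := by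
        refine integral_mono h1 ((h2.add (integrable_const _)).const_mul _) fun x => ?_
        simp only
        rw [← div_eq_inv_mul, le_div_iff₀ (by positivity)]
        have := Real.sq_sqrt (Nat.cast_nonneg (α := ℝ) d)
        nlinarith [sq_nonneg (‖x‖ - √d)]
    _ = (2 * √d)⁻¹ * (d + d) := by
        rw [integral_const_mul, integral_add h2 (integrable_const _), integral_norm_sq_stdGaussian]
        simp
    _ = √d := by
        rw [← div_eq_inv_mul, div_eq_iff (by positivity)]
        nlinarith [Real.sq_sqrt (Nat.cast_nonneg (α := ℝ) d)]

/-- Cauchy-Schwarz gives `∑ |xⱼ| ≤ √d ‖x‖`, and the left side has an explicit Gaussian mean. -/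
lemma le_integral_norm_stdGaussian :
    √(2 / Real.pi) * √d ≤ ∫ x, ‖x‖ ∂stdGaussian (Param d) := by
  rcases Nat.eq_zero_or_pos d with rfl | hd
  · simpa using integral_nonneg fun x => norm_nonneg x
  have hs : 0 < √(d : ℝ) := by positivity
  have h1 := integrable_norm_pow_stdGaussian (d := d) 1
  simp only [pow_one] at h1
  have hi : ∀ j : Fin d, Integrable
      (fun x : Param d => |inner ℝ (EuclideanSpace.single j (1 : ℝ)) x|) (stdGaussian (Param d)) :=
    fun j => (IsGaussian.integrable_dual (stdGaussian (Param d))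
      (innerSL ℝ (EuclideanSpace.single j (1 : ℝ)))).abs
  have hsum : ∫ x : Param d, ∑ j, |inner ℝ (EuclideanSpace.single j (1 : ℝ)) x|
      ∂stdGaussian (Param d) = d * √(2 / Real.pi) := by
    rw [integral_finsetSum _ fun j _ => hi j]
    have : ∀ j : Fin d, ‖(EuclideanSpace.single j (1 : ℝ) : Param d)‖ = 1 := fun j => by simp
    simp_rw [integral_abs_inner_stdGaussian (this _)]
    simp
  have h : ∫ x : Param d, ∑ j, |inner ℝ (EuclideanSpace.single j (1 : ℝ)) x|
      ∂stdGaussian (Param d) ≤ ∫ x, √d * ‖x‖ ∂stdGaussian (Param d) := by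
    refine integral_mono (integrable_finsetSum _ fun j _ => hi j) (h1.const_mul _) fun x => ?_
    simp only [EuclideanSpace.inner_single_left, map_one, one_mul]
    rw [EuclideanSpace.norm_eq, ← Real.sqrt_mul (by positivity)]
    refine Real.le_sqrt_of_sq_le ?_
    have := sq_sum_le_card_mul_sum_sq (s := Finset.univ) (f := fun j => |x j|)
    simpa using this
  rw [hsum, integral_const_mul] at h
  have h2 := Real.mul_self_sqrt (Nat.cast_nonneg (α := ℝ) d)
  refine le_of_mul_le_mul_left ?_ hs
  linarith [h, show √(d : ℝ) * (√(2 / Real.pi) * √d) = d * √(2 / Real.pi) by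
    rw [← h2]; simp only [Real.sqrt_mul_self, Real.sqrt_nonneg]; ring]

/-- Only the component of `h` along `g` contributes: the reflection that fixes `g` and negates the
orthogonal part `u` preserves the Gaussian and flips the sign of the `u` term. -/
lemma integral_sign_inner_stdGaussian {g : Param d} (hg : ‖g‖ = 1) (h : Param d) :
    ∫ x, (if 0 ≤ inner ℝ g x then 1 else -1) * inner ℝ h x ∂stdGaussian (Param d) =
      √(2 / Real.pi) * inner ℝ g h := by
  set sg : Param d → ℝ := fun x => if 0 ≤ inner ℝ g x then 1 else -1 with hsg
  have hsgm : Measurable sg :=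
    Measurable.ite (measurableSet_le measurable_const (by fun_prop)) measurable_const
      measurable_const
  have hsgb : ∀ x, ‖sg x‖ ≤ 1 := fun x => by simp only [hsg]; split_ifs <;> simp
  have hint : ∀ u : Param d, Integrable (fun x => sg x * inner ℝ u x) (stdGaussian (Param d)) :=
    fun u => (IsGaussian.integrable_dual (stdGaussian (Param d)) (innerSL ℝ u)).bdd_mul
      hsgm.aestronglyMeasurable (.of_forall hsgb)
  set u := h - (inner ℝ g h : ℝ) • g with hu
  have hgu : inner ℝ g u = 0 := by
    rw [hu, inner_sub_right, inner_smul_right, real_inner_self_eq_norm_sq, hg]; ring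
  have hzero : ∫ x, sg x * inner ℝ u x ∂stdGaussian (Param d) = 0 := by
    set K := Submodule.span ℝ {g}
    have hRg : K.reflection g = g :=
      Submodule.reflection_mem_subspace_eq_self (Submodule.mem_span_singleton_self g)
    have hRu : K.reflection u = -u := by
      refine Submodule.reflection_mem_subspace_orthogonalComplement_eq_neg ?_
      exact (Submodule.mem_orthogonal_singleton_iff_inner_right).2 hgu
    have hmap := stdGaussian_map (E := Param d) K.reflection
    have : ∫ x, sg x * inner ℝ u x ∂stdGaussian (Param d) =
        ∫ x, -(sg x * inner ℝ u x) ∂stdGaussian (Param d) := by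
      conv_lhs => rw [← hmap]
      rw [integral_map (by fun_prop) (by fun_prop)]
      refine integral_congr_ae (.of_forall fun x => ?_)
      have e1 : inner ℝ g (K.reflection x) = inner ℝ g x := by
        have := LinearIsometryEquiv.inner_map_map K.reflection g x
        rwa [hRg] at this
      have e2 : inner ℝ u (K.reflection x) = -inner ℝ u x := by
        have := LinearIsometryEquiv.inner_map_map K.reflection u x
        rw [hRu, inner_neg_left] at this
        linarith
      simp only [hsg, e1, e2]; ring
    rw [integral_neg] at this
    linarith
  have hdec : ∀ x, sg x * inner ℝ h x = inner ℝ g h * |inner ℝ g x| + sg x * inner ℝ u x := by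
    intro x
    have : h = (inner ℝ g h : ℝ) • g + u := by rw [hu]; abel
    conv_lhs => rw [this, inner_add_left, real_inner_smul_left]
    simp only [hsg]
    split_ifs with h0
    · rw [abs_of_nonneg h0]; ring
    · rw [abs_of_neg (not_le.1 h0)]; ring
  change ∫ x, sg x * inner ℝ h x ∂_ = _
  simp_rw [hdec]
  rw [integral_add _ (hint u), hzero, integral_const_mul, integral_abs_inner_stdGaussian hg]
  · ring
  · exact (IsGaussian.integrable_dual (stdGaussian (Param d)) (innerSL ℝ g)).abs.const_mul _

/-! ### The uniform distribution on the sphere -/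

/-- Polar coordinates for the standard Gaussian: direction and length are independent, and the
direction is uniform on the sphere. -/
lemma stdGaussian_eq_map_prod (hd : 0 < d) :
    stdGaussian (Param d) = ((uniformSphere d).prod
      ((stdGaussian (Param d)).map fun x => ‖x‖)).map fun p => p.2 • p.1 := by
  obtain ⟨ρ, hρ, hpos, h⟩ := exists_stdGaussian_eq_map_prod hd
  have hP := isProbabilityMeasure_uniformSphere hd
  suffices (stdGaussian (Param d)).map (fun x => ‖x‖) = ρ by rw [this, ← h]
  rw [h, Measure.map_map (by fun_prop) (by fun_prop)]
  have : ((fun x : Param d => ‖x‖) ∘ fun p : Param d × ℝ => p.2 • p.1)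
      =ᵐ[(uniformSphere d).prod ρ] Prod.snd := by
    have h1 := Measure.quasiMeasurePreserving_fst (μ := uniformSphere d) (ν := ρ)
      |>.ae (ae_norm_uniformSphere d)
    have h2 := Measure.quasiMeasurePreserving_snd (μ := uniformSphere d) (ν := ρ) |>.ae hpos
    filter_upwards [h1, h2] with p hp1 hp2
    simp [norm_smul, hp1, abs_of_pos hp2]
  rw [Measure.map_congr this, Measure.map_snd_prod]
  simp

lemma ae_norm_pos_stdGaussian (hd : 0 < d) :
    ∀ᵐ r ∂(stdGaussian (Param d)).map fun x => ‖x‖, 0 < r := by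
  have : Nonempty (Fin d) := ⟨⟨0, hd⟩⟩
  rw [ae_map_iff (by fun_prop) measurableSet_Ioi, stdGaussian_eq_withDensity]
  refine (withDensity_absolutelyContinuous _ _).ae_le ?_
  have : ∀ᵐ x : Param d, x ≠ 0 := by
    rw [ae_iff]; simp
  filter_upwards [this] with x hx
  simpa using hx

lemma isProbabilityMeasure_norm_stdGaussian :
    IsProbabilityMeasure ((stdGaussian (Param d)).map fun x => ‖x‖) :=
  Measure.isProbabilityMeasure_map (by fun_prop)

/-- Independence of length and direction makes the integral of a homogeneous function factor; this
transfers Gaussian moments to the sphere. -/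
lemma integral_homogeneous_stdGaussian (hd : 0 < d) (k : ℕ) {ψ : Param d → ℝ} (hψ : Measurable ψ)
    (hom : ∀ r : ℝ, 0 < r → ∀ z, ψ (r • z) = r ^ k * ψ z) :
    ∫ x, ψ x ∂stdGaussian (Param d) =
      (∫ x, ‖x‖ ^ k ∂stdGaussian (Param d)) * ∫ z, ψ z ∂uniformSphere d := by
  have hP := isProbabilityMeasure_uniformSphere hd
  have hR := isProbabilityMeasure_norm_stdGaussian (d := d)
  conv_lhs => rw [stdGaussian_eq_map_prod hd]
  rw [integral_map (by fun_prop) (by fun_prop), mul_comm]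
  have e : ∫ x, ‖x‖ ^ k ∂stdGaussian (Param d) =
      ∫ r, r ^ k ∂(stdGaussian (Param d)).map fun x => ‖x‖ := by
    rw [integral_map (by fun_prop) (by fun_prop)]
  rw [e, ← integral_prod_mul]
  refine integral_congr_ae ?_
  filter_upwards [Measure.quasiMeasurePreserving_snd (μ := uniformSphere d)
    |>.ae (ae_norm_pos_stdGaussian hd)] with p hp
  rw [hom _ hp, mul_comm]

/-- The mean of `|⟨g, z⟩|` for a unit vector `g` and `z` uniform on the sphere. -/
noncomputable def sphereMeanAbs (d : ℕ) : ℝ :=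
  √(2 / Real.pi) / ∫ x, ‖x‖ ∂stdGaussian (Param d)

lemma integral_norm_stdGaussian_pos (hd : 0 < d) : 0 < ∫ x, ‖x‖ ∂stdGaussian (Param d) := by
  refine lt_of_lt_of_le ?_ le_integral_norm_stdGaussian
  positivity

lemma le_sphereMeanAbs (hd : 0 < d) : 0.797 / √d ≤ sphereMeanAbs d := by
  have h : (0.797 : ℝ) ≤ √(2 / Real.pi) := by
    refine Real.le_sqrt_of_sq_le ?_
    rw [le_div_iff₀ Real.pi_pos]
    have := Real.pi_lt_d6
    norm_num at *; linarith
  unfold sphereMeanAbs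
  have := integral_norm_stdGaussian_pos hd
  have := integral_norm_stdGaussian_le (d := d)
  gcongr

lemma integral_sign_inner_uniformSphere (hd : 0 < d) {g : Param d} (hg : ‖g‖ = 1) (h : Param d) :
    ∫ z, (if 0 ≤ inner ℝ g z then 1 else -1) * inner ℝ h z ∂uniformSphere d =
      sphereMeanAbs d * inner ℝ g h := by
  have hpos := integral_norm_stdGaussian_pos hd
  have h1 := integral_homogeneous_stdGaussian hd 1
    (ψ := fun z => (if 0 ≤ inner ℝ g z then 1 else -1) * inner ℝ h z)
    ((Measurable.ite (measurableSet_le measurable_const (by fun_prop)) measurable_const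
      measurable_const).mul (by fun_prop)) (fun r hr z => by
        simp only [inner_smul_right, mul_nonneg_iff_of_pos_left hr]; ring)
  rw [integral_sign_inner_stdGaussian hg] at h1
  simp only [pow_one] at h1
  rw [sphereMeanAbs, div_mul_eq_mul_div, h1, mul_div_cancel_left₀ _ hpos.ne']

lemma integral_inner_sq_uniformSphere (hd : 0 < d) (h : Param d) :
    ∫ z, inner ℝ h z ^ 2 ∂uniformSphere d = ‖h‖ ^ 2 / d := by
  have h1 := integral_homogeneous_stdGaussian hd 2 (ψ := fun z => inner ℝ h z ^ 2)
    (by fun_prop) (fun r _ z => by simp only [inner_smul_right]; ring)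
  rw [integral_inner_sq_stdGaussian, integral_norm_sq_stdGaussian] at h1
  rw [h1, mul_div_cancel_left₀]
  positivity

lemma integrable_uniformSphere (hd : 0 < d) {ψ : Param d → ℝ} (hψ : Measurable ψ) (C : ℝ)
    (hC : ∀ z, ‖z‖ = 1 → |ψ z| ≤ C) : Integrable ψ (uniformSphere d) := by
  have hP := isProbabilityMeasure_uniformSphere hd
  refine Integrable.of_bound hψ.aestronglyMeasurable C ?_
  filter_upwards [ae_norm_uniformSphere d] with z hz using hC z hz

/-- Linear functionals of a uniform random point of the sphere are subgaussian with the same scale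
as in the Gaussian case. -/
lemma integral_exp_inner_uniformSphere_le (hd : 0 < d) (u : Param d) :
    ∫ z, Real.exp (inner ℝ u z) ∂uniformSphere d ≤ Real.exp (‖u‖ ^ 2 / d) := by
  have hP := isProbabilityMeasure_uniformSphere hd
  have hR := isProbabilityMeasure_norm_stdGaussian (d := d)
  set ρ := (stdGaussian (Param d)).map fun x => ‖x‖ with hρ
  set e := ∫ x, ‖x‖ ∂stdGaussian (Param d) with he
  have hpos : 0 < e := integral_norm_stdGaussian_pos hd
  have her : ∫ r, r ∂ρ = e := by rw [hρ, integral_map (by fun_prop) (by fun_prop)]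
  have hir : Integrable (fun r : ℝ => r) ρ := by
    rw [hρ, integrable_map_measure (by fun_prop) (by fun_prop)]
    simpa [Function.comp_def] using integrable_norm_pow_stdGaussian (d := d) 1
  have hint := integrable_exp_inner_stdGaussian (e⁻¹ • u)
  have hval := integral_exp_inner_stdGaussian (e⁻¹ • u)
  rw [stdGaussian_eq_map_prod hd, integrable_map_measure (by fun_prop) (by fun_prop),
    ← hρ] at hint
  simp only [Function.comp_def] at hint
  rw [stdGaussian_eq_map_prod hd, integral_map (by fun_prop) (by fun_prop),
    ← hρ, integral_prod _ hint] at hval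
  -- Jensen in the radial variable alone: after division by its mean `e`, the length has mean one.
  -- The tangent line of `exp` at `a` proves it. What remains is a Gaussian exponential moment with
  -- `e² ≥ 2d/π ≥ d/2`.
  have hJ : ∀ᵐ z ∂uniformSphere d, Real.exp (inner ℝ u z) ≤
      ∫ r, Real.exp (inner ℝ (e⁻¹ • u) (r • z)) ∂ρ := by
    filter_upwards [hint.prod_right_ae] with z hz
    set a := inner ℝ u z with ha
    have e1 : ∀ r : ℝ, inner ℝ (e⁻¹ • u) (r • z) = e⁻¹ * a * r := fun r => by
      rw [real_inner_smul_left, real_inner_smul_right]; ring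
    simp only [e1] at hz ⊢
    have hsub : Integrable (fun r => e⁻¹ * a * r - a) ρ :=
      (hir.const_mul _).sub (integrable_const _)
    have hlin : Integrable (fun r => Real.exp a * (1 + (e⁻¹ * a * r - a))) ρ :=
      ((integrable_const _).add hsub).const_mul _
    calc Real.exp a = ∫ r, Real.exp a * (1 + (e⁻¹ * a * r - a)) ∂ρ := by
          rw [integral_const_mul, integral_add (integrable_const _) hsub,
            integral_sub (hir.const_mul _)
            (integrable_const _), integral_const_mul, her]
          simp only [integral_const, probReal_univ, smul_eq_mul, one_mul]
          field_simp
          ring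
      _ ≤ _ := by
          refine integral_mono hlin hz fun r => ?_
          simp only
          have := Real.add_one_le_exp (e⁻¹ * a * r - a)
          calc _ ≤ Real.exp a * Real.exp (e⁻¹ * a * r - a) := by gcongr; linarith
            _ = _ := by rw [← Real.exp_add]; ring_nf
  calc ∫ z, Real.exp (inner ℝ u z) ∂uniformSphere d
      ≤ ∫ z, ∫ r, Real.exp (inner ℝ (e⁻¹ • u) (r • z)) ∂ρ ∂uniformSphere d := by
        refine integral_mono_ae ?_ hint.integral_prod_left hJ
        refine integrable_uniformSphere hd (by fun_prop) (Real.exp ‖u‖) fun z hz => ?_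
        rw [abs_of_pos (Real.exp_pos _), Real.exp_le_exp]
        simpa [hz] using real_inner_le_norm u z
    _ = Real.exp (‖e⁻¹ • u‖ ^ 2 / 2) := hval
    _ ≤ _ := by
        rw [Real.exp_le_exp, norm_smul, mul_pow, Real.norm_of_nonneg (by positivity), inv_pow]
        have h1 : √(2 / Real.pi) * √d ≤ e := le_integral_norm_stdGaussian
        have h2 : (d : ℝ) / 2 ≤ e ^ 2 := by
          calc (d : ℝ) / 2 ≤ (√(2 / Real.pi) * √d) ^ 2 := by
                rw [mul_pow, Real.sq_sqrt (by positivity), Real.sq_sqrt (by positivity),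
                  div_eq_inv_mul]
                gcongr
                rw [inv_le_comm₀ (by norm_num) (by positivity), inv_div, div_le_iff₀ (by norm_num)]
                linarith [Real.pi_le_four]
            _ ≤ e ^ 2 := by gcongr
        have hd' : (0 : ℝ) < d := by positivity
        rw [inv_mul_eq_div, div_div]
        gcongr
        linarith

/-- If the direction lies in the strip and the length is at most `√(3d)`, then the Gaussian
coordinate along `g` is at most `√3/80`. The length condition is independent of the direction and,
by Markov, has probability at least `2/3`. -/
lemma uniformSphere_abs_inner_le (hd : 0 < d) {g : Param d} (hg : ‖g‖ = 1) :
    (uniformSphere d).real {z | |inner ℝ g z| ≤ 1 / (80 * √d)} ≤ 0.026 := by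
  have hP := isProbabilityMeasure_uniformSphere hd
  have hR := isProbabilityMeasure_norm_stdGaussian (d := d)
  set ρ := (stdGaussian (Param d)).map fun x => ‖x‖ with hρ
  have hs : 0 < √(d : ℝ) := by positivity
  set S := {z : Param d | |inner ℝ g z| ≤ 1 / (80 * √d)} with hS
  set B := Set.Iic (√3 * √d) with hB
  have hSm : MeasurableSet S := measurableSet_le (by fun_prop) measurable_const
  have h1 : (uniformSphere d).real S * ρ.real B ≤ 0.8 * (√3 / 80) := by
    calc (uniformSphere d).real S * ρ.real B = ((uniformSphere d).prod ρ).real (S ×ˢ B) := by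
          rw [measureReal_prod_prod]
      _ ≤ ((uniformSphere d).prod ρ).real ((fun p : Param d × ℝ => p.2 • p.1) ⁻¹'
            {x | |inner ℝ g x| ≤ √3 / 80}) := by
          refine ENNReal.toReal_mono (measure_ne_top _ _) (measure_mono_ae ?_)
          filter_upwards [Measure.quasiMeasurePreserving_snd (μ := uniformSphere d)
            |>.ae (ae_norm_pos_stdGaussian hd)] with p hp hpS
          have hpS1 : |inner ℝ g p.1| ≤ 1 / (80 * √d) := hpS.1
          have hpS2 : p.2 ≤ √3 * √d := hpS.2
          change |inner ℝ g (p.2 • p.1)| ≤ √3 / 80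
          rw [real_inner_smul_right, abs_mul, abs_of_pos hp]
          calc p.2 * |inner ℝ g p.1| ≤ (√3 * √d) * (1 / (80 * √d)) := by gcongr
            _ = √3 / 80 := by field_simp
      _ = (stdGaussian (Param d)).real {x | |inner ℝ g x| ≤ √3 / 80} := by
          conv_rhs => rw [stdGaussian_eq_map_prod hd]
          rw [map_measureReal_apply (by fun_prop) (measurableSet_le (by fun_prop) measurable_const)]
      _ = (gaussianReal 0 1).real (Set.Icc (-(√3 / 80)) (√3 / 80)) := by
          have h := map_inner_stdGaussian g
          have : ‖g‖₊ = 1 := by ext; simpa using hg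
          rw [this, one_pow] at h
          rw [← h, map_measureReal_apply (by fun_prop) measurableSet_Icc]
          congr 1
          ext x; simp [abs_le]
      _ ≤ _ := gaussianReal_Icc_le (by positivity)
  have h2 : 2 / 3 ≤ ρ.real B := by
    have hc : ρ.real Bᶜ ≤ 1 / 3 := by
      have hm := mul_meas_ge_le_integral_of_nonneg (μ := stdGaussian (Param d))
        (f := fun x => ‖x‖ ^ 2) (.of_forall fun x => by positivity)
        (integrable_norm_pow_stdGaussian 2) (3 * d)
      rw [integral_norm_sq_stdGaussian] at hm
      have hsub : ρ.real Bᶜ ≤ (stdGaussian (Param d)).real {x | 3 * (d : ℝ) ≤ ‖x‖ ^ 2} := by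
        rw [hρ, map_measureReal_apply (by fun_prop) measurableSet_Iic.compl]
        refine measureReal_mono fun x hx => ?_
        have hx' : √3 * √d < ‖x‖ := by simpa [hB] using hx
        change 3 * (d : ℝ) ≤ ‖x‖ ^ 2
        calc 3 * (d : ℝ) = (√3 * √d) ^ 2 := by
              rw [mul_pow, Real.sq_sqrt (by norm_num), Real.sq_sqrt (by positivity)]
          _ ≤ _ := by gcongr
      have hd' : (0 : ℝ) < d := by positivity
      refine hsub.trans ?_
      nlinarith
    rw [probReal_compl_eq_one_sub measurableSet_Iic] at hc
    linarith
  have h3 : √3 ≤ 1.733 := by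
    rw [Real.sqrt_le_left (by norm_num)]; norm_num
  have h0 : 0 ≤ (uniformSphere d).real S := measureReal_nonneg
  nlinarith

/-! ### The mean of a one-bit measurement -/

/-- `y` takes the values `±1` only. -/
def IsSignValued (y : Param d → ℝ) : Prop := ∀ z, y z = 1 ∨ y z = -1

lemma IsSignValued.abs_eq {y : Param d → ℝ} (hy : IsSignValued y) (z : Param d) : |y z| = 1 := by
  rcases hy z with h | h <;> simp [h]

/-- On the sphere, `y` is the sign of `⟨g, ·⟩` outside the strip `|⟨g, z⟩| ≤ 1 / (80 √d)`. -/
def AgreesOffStrip (g : Param d) (y : Param d → ℝ) : Prop :=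
  ∀ z, ‖z‖ = 1 → 1 / (80 * √d) < |inner ℝ g z| → y z = if 0 ≤ inner ℝ g z then 1 else -1

lemma measurable_sign_inner (g : Param d) :
    Measurable fun z : Param d => if 0 ≤ inner ℝ g z then (1 : ℝ) else -1 :=
  Measurable.ite (measurableSet_le measurable_const (by fun_prop)) measurable_const measurable_const

lemma integrable_mul_inner (hd : 0 < d) {y : Param d → ℝ} (hym : Measurable y)
    (hy : IsSignValued y) (h : Param d) :
    Integrable (fun z => y z * inner ℝ h z) (uniformSphere d) := by
  refine integrable_uniformSphere hd (by fun_prop) ‖h‖ fun z hz => ?_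
  rw [abs_mul, hy.abs_eq, one_mul]
  simpa [hz] using abs_real_inner_le_norm h z

lemma isSignValued_sign_inner (g : Param d) :
    IsSignValued fun z : Param d => if 0 ≤ inner ℝ g z then (1 : ℝ) else -1 := fun z => by
  by_cases h : 0 ≤ inner ℝ g z <;> simp [h]

/-- Replacing `y` by the exact sign changes the integrand only on the strip, by at most `2|⟨h, z⟩|`.
Since the strip has measure at most `0.026` and `E⟨h, z⟩² ≤ 1/d`, this costs about `2√0.026/√d`. -/
lemma integral_mul_inner_le (hd : 0 < d) {g : Param d} (hg : ‖g‖ = 1) {y : Param d → ℝ}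
    (hym : Measurable y) (hy : IsSignValued y) (hyg : AgreesOffStrip g y) {h : Param d}
    (hh : ‖h‖ ≤ 1) :
    ∫ z, y z * inner ℝ h z ∂uniformSphere d ≤ sphereMeanAbs d * inner ℝ g h + 0.323 / √d := by
  have hP := isProbabilityMeasure_uniformSphere hd
  have hs : 0 < √(d : ℝ) := by positivity
  have hs2 : √(d : ℝ) ^ 2 = d := Real.sq_sqrt (by positivity)
  set S := {z : Param d | |inner ℝ g z| ≤ 1 / (80 * √d)} with hS
  have hSm : MeasurableSet S := measurableSet_le (by fun_prop) measurable_const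
  have hsq : Integrable (fun z => inner ℝ h z ^ 2) (uniformSphere d) := by
    refine integrable_uniformSphere hd (by fun_prop) (‖h‖ ^ 2) fun z hz => ?_
    rw [abs_pow]
    gcongr
    simpa [hz] using abs_real_inner_le_norm h z
  have hI : Integrable (S.indicator fun _ => (6.2 / √d : ℝ)) (uniformSphere d) :=
    (integrable_const _).indicator hSm
  have hsg := integrable_mul_inner hd (measurable_sign_inner g) (isSignValued_sign_inner g) h
  calc ∫ z, y z * inner ℝ h z ∂uniformSphere d
      ≤ ∫ z, ((if 0 ≤ inner ℝ g z then 1 else -1) * inner ℝ h z +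
          (S.indicator (fun _ => (6.2 / √d : ℝ)) z + √d / 6.2 * inner ℝ h z ^ 2))
          ∂uniformSphere d := by
        refine integral_mono_ae (integrable_mul_inner hd hym hy h)
          (hsg.add (hI.add (hsq.const_mul _))) ?_
        filter_upwards [ae_norm_uniformSphere d] with z hz
        by_cases hzS : z ∈ S
        · simp only [Set.indicator_of_mem hzS]
          set X := inner ℝ h z
          -- Pointwise form of Cauchy-Schwarz; the weight `6.2 ≈ 1/√0.026` nearly balances the two
          -- terms.
          have h1 : 2 * |X| ≤ 6.2 / √d + √d / 6.2 * X ^ 2 := by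
            have : 6.2 / √d + √d / 6.2 * X ^ 2 - 2 * |X| = 6.2 / √d * (1 - √d / 6.2 * |X|) ^ 2 := by
              rw [← sq_abs X]; field_simp; ring
            have : 0 ≤ 6.2 / √d * (1 - √d / 6.2 * |X|) ^ 2 := by positivity
            linarith
          have := neg_abs_le X
          have := le_abs_self X
          have := abs_nonneg X
          rcases hy z with e | e <;> rw [e] <;> split_ifs <;> linarith
        · simp only [Set.indicator_of_notMem hzS]
          rw [hyg z hz (not_le.1 hzS)]
          have : 0 ≤ √d / 6.2 * inner ℝ h z ^ 2 := by positivity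
          linarith
    _ = sphereMeanAbs d * inner ℝ g h + (6.2 / √d * (uniformSphere d).real S +
          √d / 6.2 * (‖h‖ ^ 2 / d)) := by
        have hI2 : Integrable (fun z => S.indicator (fun _ => (6.2 / √d : ℝ)) z +
          √d / 6.2 * inner ℝ h z ^ 2) (uniformSphere d) := hI.add (hsq.const_mul _)
        rw [integral_add hsg hI2, integral_sign_inner_uniformSphere hd hg,
          integral_add hI (hsq.const_mul _), integral_const_mul,
          integral_inner_sq_uniformSphere hd, integral_indicator_const _ hSm, smul_eq_mul,
          mul_comm ((uniformSphere d).real S)]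
    _ ≤ sphereMeanAbs d * inner ℝ g h + (6.2 / √d * 0.026 + √d / 6.2 * (1 / d)) := by
        have := uniformSphere_abs_inner_le hd hg
        have : ‖h‖ ^ 2 ≤ 1 := by nlinarith [norm_nonneg h]
        gcongr
    _ ≤ _ := by
        have : √d / 6.2 * (1 / d) = (1 / 6.2) / √d := by
          rw [← hs2]; simp only [Real.sqrt_sq hs.le]; field_simp
        rw [this, div_mul_eq_mul_div, ← add_div]
        gcongr
        norm_num

/-- In the direction `g` itself a wrong sign costs little, since `|⟨g, z⟩|` is at most `1/(80√d)`
wherever the sign can be wrong. -/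
lemma le_integral_mul_inner (hd : 0 < d) {g : Param d} (hg : ‖g‖ = 1) {y : Param d → ℝ}
    (hym : Measurable y) (hy : IsSignValued y) (hyg : AgreesOffStrip g y) :
    sphereMeanAbs d - 0.025 / √d ≤ ∫ z, y z * inner ℝ g z ∂uniformSphere d := by
  have hP := isProbabilityMeasure_uniformSphere hd
  have hs : 0 < √(d : ℝ) := by positivity
  have hsg := integrable_mul_inner hd (measurable_sign_inner g) (isSignValued_sign_inner g) g
  have h1 := integral_sign_inner_uniformSphere hd hg g
  rw [real_inner_self_eq_norm_sq, hg, one_pow, mul_one] at h1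
  calc sphereMeanAbs d - 0.025 / √d
      = ∫ z, ((if 0 ≤ inner ℝ g z then 1 else -1) * inner ℝ g z - 0.025 / √d)
          ∂uniformSphere d := by
        rw [integral_sub hsg (integrable_const _), h1]; simp
    _ ≤ _ := by
        refine integral_mono_ae (hsg.sub (integrable_const _)) (integrable_mul_inner hd hym hy g) ?_
        filter_upwards [ae_norm_uniformSphere d] with z hz
        by_cases hzS : |inner ℝ g z| ≤ 1 / (80 * √d)
        · have e : 0.025 / √d = 2 * (1 / (80 * √d)) := by field_simp; norm_num
          rw [e]
          set X := inner ℝ g z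
          have := neg_abs_le X
          have := le_abs_self X
          have := abs_nonneg X
          rcases hy z with e | e <;> rw [e] <;> split_ifs <;> linarith
        · rw [hyg z hz (not_le.1 hzS)]
          have : 0 ≤ 0.025 / √d := by positivity
          linarith

/-- The mean of `y(z) z` over the sphere. -/
noncomputable def signMean (y : Param d → ℝ) : Param d := ∫ z, y z • z ∂uniformSphere d

lemma inner_signMean (hd : 0 < d) {y : Param d → ℝ} (hym : Measurable y)
    (hy : IsSignValued y) (h : Param d) :
    inner ℝ h (signMean y) = ∫ z, y z * inner ℝ h z ∂uniformSphere d := by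
  have hP := isProbabilityMeasure_uniformSphere hd
  have hi : Integrable (fun z : Param d => y z • z) (uniformSphere d) := by
    refine Integrable.of_bound (by fun_prop) 1 ?_
    filter_upwards [ae_norm_uniformSphere d] with z hz
    rw [norm_smul, Real.norm_eq_abs, hy.abs_eq, hz, one_mul]
  rw [signMean, ← integral_inner hi]
  simp_rw [real_inner_smul_right]

/-- Centered one-bit measurements are subgaussian. -/
lemma integral_exp_centered_le (hd : 0 < d) {y : Param d → ℝ} (hym : Measurable y)
    (hy : IsSignValued y) (u : Param d) :
    ∫ z, Real.exp (inner ℝ u (y z • z - signMean y)) ∂uniformSphere d ≤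
      Real.exp (2 * ‖u‖ ^ 2 / d) := by
  have hP := isProbabilityMeasure_uniformSphere hd
  have hbd : ∀ c : ℝ, |c| = 1 → Integrable (fun z => Real.exp (c * (y z * inner ℝ u z)))
      (uniformSphere d) := by
    intro c hc
    refine integrable_uniformSphere hd (by fun_prop) (Real.exp ‖u‖) fun z hz => ?_
    rw [abs_of_pos (Real.exp_pos _), Real.exp_le_exp]
    refine (le_abs_self _).trans ?_
    rw [abs_mul, abs_mul, hc, hy.abs_eq, one_mul, one_mul]
    simpa [hz] using abs_real_inner_le_norm u z
  have hp : Integrable (fun z => Real.exp (y z * inner ℝ u z)) (uniformSphere d) := by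
    simpa using hbd 1 (by simp)
  have hn : Integrable (fun z => Real.exp (-(y z * inner ℝ u z))) (uniformSphere d) := by
    simpa using hbd (-1) (by simp)
  set A := ∫ z, Real.exp (y z * inner ℝ u z) ∂uniformSphere d with hA
  set B := ∫ z, Real.exp (-(y z * inner ℝ u z)) ∂uniformSphere d with hB
  have hA0 : 0 ≤ A := integral_nonneg fun z => (Real.exp_pos _).le
  set μ := inner ℝ u (signMean y) with hμ
  have hμe : μ = ∫ z, y z * inner ℝ u z ∂uniformSphere d := inner_signMean hd hym hy u
  -- Symmetrization: by Jensen the centering factor is at most `B`, and `AB ≤ ((A + B)/2)²`. The sum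
  -- `A + B` no longer depends on `y`, because a sign only swaps the two exponentials.
  have hJ : Real.exp (-μ) ≤ B := by
    have hi := integrable_mul_inner hd hym hy u
    have hsub : Integrable (fun z => μ - y z * inner ℝ u z) (uniformSphere d) :=
      (integrable_const _).sub hi
    calc Real.exp (-μ) = ∫ z, Real.exp (-μ) * (1 + (μ - y z * inner ℝ u z)) ∂uniformSphere d := by
          rw [integral_const_mul, integral_add (integrable_const _) hsub,
            integral_sub (integrable_const _) hi, ← hμe]
          simp
      _ ≤ B := by
          refine integral_mono (((integrable_const _).add hsub).const_mul _) hn fun z => ?_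
          simp only
          have := Real.add_one_le_exp (μ - y z * inner ℝ u z)
          calc _ ≤ Real.exp (-μ) * Real.exp (μ - y z * inner ℝ u z) := by gcongr; linarith
            _ = _ := by rw [← Real.exp_add]; ring_nf
  have hAB : A + B ≤ 2 * Real.exp (‖u‖ ^ 2 / d) := by
    have h1 := integral_exp_inner_uniformSphere_le hd u
    have h2 := integral_exp_inner_uniformSphere_le hd (-u)
    rw [norm_neg] at h2
    have hi : ∀ v : Param d, Integrable (fun z => Real.exp (inner ℝ v z)) (uniformSphere d) := by
      intro v
      refine integrable_uniformSphere hd (by fun_prop) (Real.exp ‖v‖) fun z hz => ?_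
      rw [abs_of_pos (Real.exp_pos _), Real.exp_le_exp]
      simpa [hz] using real_inner_le_norm v z
    have e : A + B = ∫ z, Real.exp (inner ℝ u z) ∂uniformSphere d +
        ∫ z, Real.exp (inner ℝ (-u) z) ∂uniformSphere d := by
      rw [hA, hB, ← integral_add hp hn, ← integral_add (hi u) (hi (-u))]
      refine integral_congr_ae (.of_forall fun z => ?_)
      rcases hy z with e | e <;> simp only [e, inner_neg_left, one_mul, neg_mul, neg_neg]
      ring
    linarith
  have hE : ∫ z, Real.exp (inner ℝ u (y z • z - signMean y)) ∂uniformSphere d =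
      A * Real.exp (-μ) := by
    rw [hA, ← integral_mul_const]
    refine integral_congr_ae (.of_forall fun z => ?_)
    simp only [inner_sub_right, real_inner_smul_right, ← Real.exp_add]
    rfl
  have hB0 : 0 ≤ B := (Real.exp_pos _).le.trans hJ
  calc _ = A * Real.exp (-μ) := hE
    _ ≤ A * B := by gcongr
    _ ≤ ((A + B) / 2) ^ 2 := by nlinarith [sq_nonneg (A - B)]
    _ ≤ Real.exp (‖u‖ ^ 2 / d) ^ 2 := by gcongr; linarith
    _ = _ := by rw [← Real.exp_nat_mul]; congr 1; push_cast; ring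

/-- The centered average of `m` one-bit measurements. -/
noncomputable def deviation {m : ℕ} (y : Param d → ℝ) (z : Fin m → Param d) : Param d :=
  (m : ℝ)⁻¹ • ∑ i, (y (z i) • z i - signMean y)

lemma measurable_deviation {m : ℕ} {y : Param d → ℝ} (hym : Measurable y) :
    Measurable (deviation (m := m) y) := by
  unfold deviation; fun_prop

lemma lintegral_exp_deviation_le (hd : 0 < d) {m : ℕ} (hm : 0 < m) {y : Param d → ℝ}
    (hym : Measurable y) (hy : IsSignValued y) (u : Param d) :
    ∫⁻ z, ENNReal.ofReal (Real.exp (inner ℝ u (deviation y z)))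
        ∂Measure.pi (fun _ : Fin m => uniformSphere d) ≤
      ENNReal.ofReal (Real.exp (2 / (m * d) * ‖u‖ ^ 2)) := by
  have hP := isProbabilityMeasure_uniformSphere hd
  have e : ∀ z : Fin m → Param d, Real.exp (inner ℝ u (deviation y z)) =
      ∏ i, Real.exp (inner ℝ ((m : ℝ)⁻¹ • u) (y (z i) • z i - signMean y)) := by
    intro z
    rw [← Real.exp_sum, deviation, inner_smul_right, inner_sum, Finset.mul_sum]
    simp_rw [real_inner_smul_left]
  have hi : Integrable (fun z => Real.exp (inner ℝ ((m : ℝ)⁻¹ • u) (y z • z - signMean y)))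
      (uniformSphere d) := by
    refine integrable_uniformSphere hd (by fun_prop)
      (Real.exp (‖(m : ℝ)⁻¹ • u‖ * (1 + ‖signMean y‖))) fun z hz => ?_
    rw [abs_of_pos (Real.exp_pos _), Real.exp_le_exp]
    refine (real_inner_le_norm _ _).trans ?_
    gcongr
    refine (norm_sub_le _ _).trans ?_
    rw [norm_smul, Real.norm_eq_abs, hy.abs_eq, hz, one_mul]
  simp_rw [e]
  rw [← ofReal_integral_eq_lintegral_ofReal (Integrable.fintype_prod fun _ => hi)
    (.of_forall fun z => Finset.prod_nonneg fun i _ => (Real.exp_pos _).le),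
    integral_fintype_prod_eq_pow (fun z => Real.exp (inner ℝ ((m : ℝ)⁻¹ • u) (y z • z - signMean y))),
    Fintype.card_fin]
  refine ENNReal.ofReal_le_ofReal ?_
  calc _ ≤ Real.exp (2 * ‖(m : ℝ)⁻¹ • u‖ ^ 2 / d) ^ m :=
        pow_le_pow_left₀ (integral_nonneg fun z => (Real.exp_pos _).le)
          (integral_exp_centered_le hd hym hy _) _
    _ = _ := by
        rw [← Real.exp_nat_mul, norm_smul, norm_inv, Real.norm_natCast]
        congr 1
        field_simp

/-! ### Uniform deviations over the constraint set -/

lemma lintegral_exp_sq_gaussianReal :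
    ∫⁻ x, ENNReal.ofReal (Real.exp (x ^ 2 / 4)) ∂gaussianReal 0 1 = ENNReal.ofReal √2 := by
  have e : ∀ x : ℝ, gaussianPDF 0 1 x * ENNReal.ofReal (Real.exp (x ^ 2 / 4)) =
      ENNReal.ofReal ((√(2 * Real.pi))⁻¹ * Real.exp (-(1 / 4) * x ^ 2)) := by
    intro x
    rw [gaussianPDF, ← ENNReal.ofReal_mul (gaussianPDFReal_nonneg _ _ _)]
    congr 1
    simp only [gaussianPDFReal, NNReal.coe_one, mul_one, sub_zero]
    rw [mul_assoc, ← Real.exp_add]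
    congr 2
    ring
  rw [gaussianReal_of_var_ne_zero _ one_ne_zero, lintegral_withDensity_eq_lintegral_mul _
    (measurable_gaussianPDF 0 1) (by fun_prop)]
  simp only [Pi.mul_apply, e]
  rw [← ofReal_integral_eq_lintegral_ofReal
    ((integrable_exp_neg_mul_sq (by norm_num)).const_mul _) (.of_forall fun x => by positivity),
    integral_const_mul, integral_gaussian]
  congr 1
  rw [← Real.sqrt_inv, ← Real.sqrt_mul (by positivity)]
  congr 1
  field_simp
  norm_num

/-- Writes the exponential of a square as a Gaussian average of exponentials of linear terms, to
which a subgaussian hypothesis applies. -/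
lemma ofReal_exp_sq_eq_lintegral {a : ℝ} (ha : 0 ≤ a) (w : ℝ) :
    ENNReal.ofReal (Real.exp (a * w ^ 2)) =
      ∫⁻ x, ENNReal.ofReal (Real.exp (√(2 * a) * x * w)) ∂gaussianReal 0 1 := by
  have h := mgf_id_gaussianReal (μ := 0) (v := 1)
  have h2 := congrFun h (√(2 * a) * w)
  have hi := integrable_exp_mul_gaussianReal (μ := 0) (v := 1) (√(2 * a) * w)
  have e : ∀ x, √(2 * a) * x * w = √(2 * a) * w * x := fun x => by ring
  simp_rw [e]
  rw [← ofReal_integral_eq_lintegral_ofReal hi (.of_forall fun x => (Real.exp_pos _).le)]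
  simp only [mgf, id] at h2
  rw [h2, mul_pow, Real.sq_sqrt (by positivity)]
  congr 2
  simp
  ring

/-- Exponential moments of the squared coordinates of a subgaussian vector, thinned by a weight `p`
and taken jointly over a set of coordinates. -/
lemma lintegral_exp_mul_prod_le {Ω : Type*} [MeasurableSpace Ω] {P : Measure Ω} [SFinite P]
    {w : Ω → Param d} (hw : Measurable w) {B a p : ℝ} (ha : 0 ≤ a) (hp : 0 ≤ p)
    (haB : 8 * a * B = 1)
    (hsub : ∀ u, ∫⁻ ω, ENNReal.ofReal (Real.exp (inner ℝ u (w ω))) ∂P ≤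
      ENNReal.ofReal (Real.exp (B * ‖u‖ ^ 2))) (A : Finset (Fin d)) :
    ∀ u : Param d, (∀ j ∈ A, u j = 0) →
      ∫⁻ ω, ENNReal.ofReal (Real.exp (inner ℝ u (w ω)) *
        ∏ j ∈ A, (1 + p * Real.exp (a * w ω j ^ 2))) ∂P ≤
      ENNReal.ofReal (Real.exp (B * ‖u‖ ^ 2) * (1 + √2 * p) ^ A.card) := by
  have hwj : ∀ j, Measurable fun ω => w ω j := fun j => by fun_prop
  induction A using Finset.induction_on with
  | empty => simpa using hsub
  | insert j A hj ih =>
    intro u hu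
    have huA : ∀ i ∈ A, u i = 0 := fun i hi => hu i (Finset.mem_insert_of_mem hi)
    have huj : u j = 0 := hu j (Finset.mem_insert_self _ _)
    set R : Ω → ℝ := fun ω => ∏ i ∈ A, (1 + p * Real.exp (a * w ω i ^ 2)) with hR
    have hR0 : ∀ ω, 0 ≤ R ω := fun ω => Finset.prod_nonneg fun i _ => by positivity
    have hRm : Measurable R := by
      refine Finset.measurable_prod _ fun i _ => ?_
      have := hwj i
      fun_prop
    set K : ℝ := (1 + √2 * p) ^ A.card with hK
    have hK0 : 0 ≤ K := by positivity
    -- Linearizing the square in coordinate `j` shifts `u` along that axis, which is why the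
    -- induction keeps `u` general. As `u j = 0`, the shift adds `2a x²` to `‖u‖²`, and `8aB = 1`
    -- turns this into the factor `exp(x²/4)`, of mean `√2`.
    set v : ℝ → Param d := fun x => u + (√(2 * a) * x) • EuclideanSpace.single j 1 with hv
    have hvA : ∀ x, ∀ i ∈ A, v x i = 0 := by
      intro x i hi
      have : i ≠ j := fun h => hj (h ▸ hi)
      simp [hv, huA i hi, this]
    have hvn : ∀ x, ‖v x‖ ^ 2 = ‖u‖ ^ 2 + 2 * a * x ^ 2 := by
      intro x
      rw [hv, norm_add_sq_real, inner_smul_right, EuclideanSpace.inner_single_right, huj, norm_smul,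
        mul_pow, Real.norm_eq_abs, sq_abs, mul_pow, Real.sq_sqrt (by positivity)]
      simp
    have hvi : ∀ x ω, inner ℝ (v x) (w ω) = inner ℝ u (w ω) + √(2 * a) * x * w ω j := by
      intro x ω
      rw [hv, inner_add_left, real_inner_smul_left, EuclideanSpace.inner_single_left]
      simp
    have hsq : ∀ ω, ENNReal.ofReal (Real.exp (inner ℝ u (w ω)) * R ω * Real.exp (a * w ω j ^ 2)) =
        ∫⁻ x, ENNReal.ofReal (Real.exp (inner ℝ (v x) (w ω)) * R ω) ∂gaussianReal 0 1 := by
      intro ω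
      have h0 : 0 ≤ Real.exp (inner ℝ u (w ω)) * R ω := mul_nonneg (Real.exp_pos _).le (hR0 ω)
      rw [ENNReal.ofReal_mul h0, ofReal_exp_sq_eq_lintegral ha,
        ← lintegral_const_mul _ (by fun_prop)]
      refine lintegral_congr fun x => ?_
      rw [← ENNReal.ofReal_mul h0, hvi, Real.exp_add]
      congr 1; ring
    have hsecond : ∫⁻ ω, ENNReal.ofReal (Real.exp (inner ℝ u (w ω)) * R ω *
        Real.exp (a * w ω j ^ 2)) ∂P ≤ ENNReal.ofReal (Real.exp (B * ‖u‖ ^ 2) * K * √2) := by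
      simp_rw [hsq]
      have hjm := hwj j
      rw [lintegral_lintegral_swap (by simp only [hvi]; fun_prop)]
      calc _ ≤ ∫⁻ x, ENNReal.ofReal (Real.exp (B * ‖v x‖ ^ 2) * K) ∂gaussianReal 0 1 :=
            lintegral_mono fun x => ih (v x) (hvA x)
        _ = ∫⁻ x, ENNReal.ofReal (Real.exp (B * ‖u‖ ^ 2) * K) *
              ENNReal.ofReal (Real.exp (x ^ 2 / 4)) ∂gaussianReal 0 1 := by
            refine lintegral_congr fun x => ?_
            rw [← ENNReal.ofReal_mul (by positivity), hvn]
            have : B * (‖u‖ ^ 2 + 2 * a * x ^ 2) = B * ‖u‖ ^ 2 + x ^ 2 / 4 := by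
              linear_combination (x ^ 2 / 4) * haB
            rw [this, Real.exp_add]
            congr 1; ring
        _ = _ := by
            rw [lintegral_const_mul _ (by fun_prop), lintegral_exp_sq_gaussianReal,
              ← ENNReal.ofReal_mul (by positivity)]
    have hsplit : ∀ ω, ENNReal.ofReal (Real.exp (inner ℝ u (w ω)) *
        ∏ i ∈ insert j A, (1 + p * Real.exp (a * w ω i ^ 2))) =
        ENNReal.ofReal (Real.exp (inner ℝ u (w ω)) * R ω) + ENNReal.ofReal p *
          ENNReal.ofReal (Real.exp (inner ℝ u (w ω)) * R ω * Real.exp (a * w ω j ^ 2)) := by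
      intro ω
      have h0 : 0 ≤ Real.exp (inner ℝ u (w ω)) * R ω := mul_nonneg (Real.exp_pos _).le (hR0 ω)
      rw [← ENNReal.ofReal_mul hp, ← ENNReal.ofReal_add h0 (by positivity),
        Finset.prod_insert hj]
      congr 1; ring
    simp_rw [hsplit]
    have hjm := hwj j
    rw [lintegral_add_left (by fun_prop), lintegral_const_mul _ (by fun_prop)]
    calc _ ≤ ENNReal.ofReal (Real.exp (B * ‖u‖ ^ 2) * K) +
          ENNReal.ofReal p * ENNReal.ofReal (Real.exp (B * ‖u‖ ^ 2) * K * √2) := by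
          gcongr
          exact ih u huA
      _ = _ := by
          rw [← ENNReal.ofReal_mul hp, ← ENNReal.ofReal_add (by positivity) (by positivity),
            Finset.card_insert_of_notMem hj, pow_succ]
          congr 1; rw [hK]; ring

/-- Soft thresholding at the level `τ` where `p exp(a τ²) = 1`. The logarithm of each factor
dominates `a (|wⱼ| - τ)₊²`, so the excess has Euclidean norm at most `√(log N / a)`; the truncated
part is at most `τ` per coordinate and pairs with the `ℓ₁` norm. -/
lemma inner_le_of_prod_le {w : Param d} {a p N s : ℝ} (ha : 0 < a) (hp : 0 < p) (hp1 : p ≤ 1)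
    (hN : ∏ j, (1 + p * Real.exp (a * w j ^ 2)) ≤ N) {h : Param d} (hh : h ∈ feasible d s) :
    inner ℝ w h ≤ √(Real.log N / a) + √(Real.log (1 / p) / a) * √s := by
  set τ := √(Real.log (1 / p) / a) with hτ
  have hlp : 0 ≤ Real.log (1 / p) := Real.log_nonneg (by rw [le_div_iff₀ hp]; linarith)
  have hτ2 : a * τ ^ 2 = Real.log (1 / p) := by
    rw [hτ, Real.sq_sqrt (by positivity)]; field_simp
  have hτ0 : 0 ≤ τ := Real.sqrt_nonneg _
  have hterm : ∀ j, a * (max (|w j| - τ) 0) ^ 2 ≤ Real.log (1 + p * Real.exp (a * w j ^ 2)) := by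
    intro j
    rcases le_total (|w j|) τ with hle | hle
    · rw [max_eq_right (by linarith)]
      simp only [ne_eq, OfNat.ofNat_ne_zero, not_false_eq_true, zero_pow, mul_zero]
      refine Real.log_nonneg ?_
      have : 0 ≤ p * Real.exp (a * w j ^ 2) := by positivity
      linarith
    · rw [max_eq_left (by linarith)]
      calc a * (|w j| - τ) ^ 2 ≤ a * w j ^ 2 - a * τ ^ 2 := by
            rw [← sq_abs (w j)]
            nlinarith [mul_nonneg ha.le (mul_nonneg hτ0 (sub_nonneg.2 hle))]
        _ = Real.log (p * Real.exp (a * w j ^ 2)) := by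
            rw [hτ2, Real.log_mul hp.ne' (Real.exp_pos _).ne', Real.log_exp, one_div, Real.log_inv]
            ring
        _ ≤ _ := by
            gcongr
            linarith
  have hsum : ∑ j, (max (|w j| - τ) 0) ^ 2 ≤ Real.log N / a := by
    rw [le_div_iff₀ ha, mul_comm, Finset.mul_sum]
    calc _ ≤ ∑ j, Real.log (1 + p * Real.exp (a * w j ^ 2)) := Finset.sum_le_sum fun j _ => hterm j
      _ = Real.log (∏ j, (1 + p * Real.exp (a * w j ^ 2))) := by
          rw [Real.log_prod fun j _ => by positivity]
      _ ≤ _ := Real.log_le_log (Finset.prod_pos fun j _ => by positivity) hN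
  calc inner ℝ w h = ∑ j, w j * h j := by simp [PiLp.inner_apply, mul_comm]
    _ ≤ ∑ j, (max (|w j| - τ) 0 * |h j| + τ * |h j|) := by
        refine Finset.sum_le_sum fun j _ => ?_
        calc w j * h j ≤ |w j| * |h j| := by rw [← abs_mul]; exact le_abs_self _
          _ ≤ (max (|w j| - τ) 0 + τ) * |h j| := by
              gcongr; linarith [le_max_left (|w j| - τ) 0]
          _ = _ := by ring
    _ = ∑ j, max (|w j| - τ) 0 * |h j| + τ * l1Norm h := by
        rw [Finset.sum_add_distrib, l1Norm, Finset.mul_sum]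
    _ ≤ √(Real.log N / a) * 1 + τ * √s := by
        gcongr
        · refine (Real.sum_mul_le_sqrt_mul_sqrt _ _ _).trans ?_
          gcongr
          simp only [sq_abs]
          simpa [EuclideanSpace.norm_eq] using hh.2
        · exact hh.1
    _ = _ := by rw [mul_one]

/-! ### Quality of the estimated direction -/

lemma l1Norm_neg (g : Param d) : l1Norm (-g) = l1Norm g := by simp [l1Norm]

lemma measure_deviation_le (hd : 0 < d) {m : ℕ} (hm : 0 < m) {s : ℝ} (hs1 : 1 ≤ s) (hsd : s ≤ d)
    {y : Param d → ℝ} (hym : Measurable y) (hy : IsSignValued y) {q : ℝ} (hq : 0 < q)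
    (hm1 : 102400 * (√2 * s + Real.log (1 / q)) ≤ m)
    (hm2 : 102400 * (s * Real.log (d / s)) ≤ m) :
    Measure.pi (fun _ : Fin m => uniformSphere d)
        {z | ¬ ∀ h ∈ feasible d s, inner ℝ (deviation y z) h ≤ 0.025 / √d} ≤
      ENNReal.ofReal q := by
  have hP := isProbabilityMeasure_uniformSphere hd
  have hd' : (0 : ℝ) < d := by positivity
  have hm' : (0 : ℝ) < m := by positivity
  have hs0 : 0 < s := by linarith
  -- Solves `8aB = 1` for the subgaussian constant `B = 2/(md)`. With `p = s/d` the expected product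
  -- is at most `(1 + √2 s/d)^d ≤ exp(√2 s)`, and `N` is the Markov threshold for failure
  -- probability `q`.
  set a : ℝ := m * d / 16 with ha
  have ha0 : 0 < a := by positivity
  set p : ℝ := s / d with hp
  have hp0 : 0 < p := by positivity
  have hp1 : p ≤ 1 := by rw [hp, div_le_one hd']; exact hsd
  set N : ℝ := Real.exp (√2 * s) / q with hN
  have hN0 : 0 < N := by positivity
  set X : (Fin m → Param d) → ℝ :=
    fun z => ∏ j, (1 + p * Real.exp (a * deviation y z j ^ 2)) with hX
  have hXm : Measurable X := by
    have := measurable_deviation (m := m) hym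
    refine Finset.measurable_prod _ fun j _ => ?_
    have : Measurable fun z : Fin m → Param d => deviation y z j := by fun_prop
    fun_prop
  have hEX : ∫⁻ z, ENNReal.ofReal (X z) ∂Measure.pi (fun _ : Fin m => uniformSphere d) ≤
      ENNReal.ofReal (Real.exp (√2 * s)) := by
    have h := lintegral_exp_mul_prod_le (P := Measure.pi (fun _ : Fin m => uniformSphere d))
      (measurable_deviation (m := m) hym) (B := 2 / (m * d)) ha0.le hp0.le
      (by rw [ha]; field_simp; norm_num) (lintegral_exp_deviation_le hd hm hym hy) Finset.univ 0
      (by simp)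
    simp only [inner_zero_left, Real.exp_zero, one_mul, norm_zero, ne_eq, OfNat.ofNat_ne_zero,
      not_false_eq_true, zero_pow, mul_zero, Finset.card_univ, Fintype.card_fin] at h
    refine h.trans (ENNReal.ofReal_le_ofReal ?_)
    calc (1 + √2 * p) ^ d ≤ Real.exp (√2 * p) ^ d := by
          gcongr; linarith [Real.add_one_le_exp (√2 * p)]
      _ = _ := by rw [← Real.exp_nat_mul, hp]; congr 1; field_simp
  have hsub : {z : Fin m → Param d | ¬ ∀ h ∈ feasible d s, inner ℝ (deviation y z) h ≤ 0.025 / √d} ⊆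
      {z | ENNReal.ofReal N ≤ ENNReal.ofReal (X z)} := by
    intro z hz
    by_contra hlt
    have hXN : X z ≤ N := by
      have : ENNReal.ofReal (X z) < ENNReal.ofReal N := not_le.1 hlt
      exact ((ENNReal.ofReal_lt_ofReal_iff hN0).1 this).le
    refine hz fun h hh => ?_
    refine (inner_le_of_prod_le ha0 hp0 hp1 hXN hh).trans ?_
    have e : Real.log N = √2 * s + Real.log (1 / q) := by
      rw [hN, Real.log_div (Real.exp_pos _).ne' hq.ne', Real.log_exp, one_div, Real.log_inv]; ring
    -- Half of the budget `0.025/√d` goes to each term. As `0.0125 = 1/80`, this requires `m ≥ 16 ·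
    -- 80² · log N`, whence `102400`.
    have b1 : √(Real.log N / a) ≤ 0.0125 / √d := by
      rw [Real.sqrt_le_left (by positivity), div_pow, Real.sq_sqrt hd'.le, e, ha,
        div_le_div_iff₀ (by positivity) hd']
      nlinarith
    have b2 : √(Real.log (1 / p) / a) * √s ≤ 0.0125 / √d := by
      rw [← Real.sqrt_mul' _ hs0.le, Real.sqrt_le_left (by positivity), div_pow,
        Real.sq_sqrt hd'.le, ha, hp, one_div_div, div_mul_eq_mul_div,
        div_le_div_iff₀ (by positivity) hd']
      nlinarith
    calc _ ≤ 0.0125 / √d + 0.0125 / √d := add_le_add b1 b2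
      _ = _ := by ring
  calc _ ≤ _ := measure_mono hsub
    _ ≤ (∫⁻ z, ENNReal.ofReal (X z) ∂Measure.pi (fun _ : Fin m => uniformSphere d)) /
          ENNReal.ofReal N :=
        meas_ge_le_lintegral_div (by fun_prop) (by simpa using hN0) (by simp)
    _ ≤ ENNReal.ofReal (Real.exp (√2 * s)) / ENNReal.ofReal N := by gcongr
    _ = _ := by
        rw [← ENNReal.ofReal_div_of_pos hN0, hN]
        congr 1
        field_simp

/-- With high probability, maximizers of the one-bit objective correlate with `g`. -/
lemma measure_not_correlated_le (hd : 0 < d) {m : ℕ} (hm : 0 < m) {s : ℝ} (hs1 : 1 ≤ s)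
    (hsd : s ≤ d) {g : Param d} (hg : ‖g‖ = 1) (hgs : l1Norm g ≤ √s)
    {y : Param d → ℝ} (hym : Measurable y) (hy : IsSignValued y) (hyg : AgreesOffStrip g y)
    {q : ℝ} (hq : 0 < q)
    (hm1 : 102400 * (√2 * s + Real.log (1 / q)) ≤ m)
    (hm2 : 102400 * (s * Real.log (d / s)) ≤ m) :
    Measure.pi (fun _ : Fin m => uniformSphere d)
        {z | ¬ ∀ e ∈ feasible d s, ∑ i, y (z i) * inner ℝ (z i) g ≤ ∑ i, y (z i) * inner ℝ (z i) e →
          1 / 2 ≤ inner ℝ g e} ≤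
      ENNReal.ofReal q := by
  refine (measure_mono ?_).trans (measure_deviation_le hd hm hs1 hsd hym hy hq hm1 hm2)
  intro z hz hdev
  refine hz fun e he hmax => ?_
  have hm' : (0 : ℝ) < m := by positivity
  have hsd' : 0 < √(d : ℝ) := by positivity
  have hdec : ∀ h : Param d, ∑ i, y (z i) * inner ℝ (z i) h =
      m * (inner ℝ (deviation y z) h + inner ℝ h (signMean y)) := by
    intro h
    rw [deviation, real_inner_smul_left, sum_inner, real_inner_comm _ h]
    simp_rw [inner_sub_left, real_inner_smul_left]
    rw [Finset.sum_sub_distrib]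
    simp only [Finset.sum_const, Finset.card_univ, Fintype.card_fin, nsmul_eq_mul]
    field_simp
    ring
  rw [hdec, hdec, mul_le_mul_iff_right₀ hm', inner_signMean hd hym hy, inner_signMean hd hym hy]
    at hmax
  have h1 := hdev e he
  have h2 := hdev (-g) ⟨by rwa [l1Norm_neg], by rw [norm_neg, hg]⟩
  rw [inner_neg_right] at h2
  have h3 := integral_mul_inner_le hd hg hym hy hyg he.2
  have h4 := le_integral_mul_inner hd hg hym hy hyg
  have h5 := le_sphereMeanAbs hd
  set lam := sphereMeanAbs d
  -- With `b = 1/√d`, the inequalities combine to `λ (1 - ⟨g, e⟩) ≤ (0.323 + 3 · 0.025) b = 0.398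
  -- b`, whereas `⟨g, e⟩ < 1/2` would force more than `λ/2 ≥ 0.3985 b`.
  by_contra hlt
  have hlt := not_le.1 hlt
  have hinv : 0 < 1 / √(d : ℝ) := by positivity
  rw [← mul_one_div] at h1 h2 h3 h4 h5
  set b := 1 / √(d : ℝ)
  have hlam : 0 < lam := by nlinarith
  nlinarith

/-- On the line, unit vectors avoid the strip, so every measurement `y(z) z` equals `g` exactly and
any positive `m` suffices. This case is separate because for `d = 1` the prescribed sample size can
be too small for the concentration bound. -/
lemma measure_not_correlated_of_dim_one {m : ℕ} (hm : 0 < m) {s : ℝ}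
    {g : Param 1} (hg : ‖g‖ = 1) {y : Param 1 → ℝ} (hyg : AgreesOffStrip g y) :
    Measure.pi (fun _ : Fin m => uniformSphere 1)
        {z | ¬ ∀ e ∈ feasible 1 s, ∑ i, y (z i) * inner ℝ (z i) g ≤ ∑ i, y (z i) * inner ℝ (z i) e →
          1 / 2 ≤ inner ℝ g e} = 0 := by
  have hP := isProbabilityMeasure_uniformSphere (d := 1) one_pos
  have hall : ∀ᵐ z ∂Measure.pi (fun _ : Fin m => uniformSphere 1), ∀ i, ‖z i‖ = 1 := by
    rw [ae_all_iff]
    exact fun i => (Measure.quasiMeasurePreserving_eval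
      (μ := fun _ : Fin m => uniformSphere 1) i).ae (ae_norm_uniformSphere 1)
  rw [← nonpos_iff_eq_zero, ← (ae_iff.1 hall)]
  refine measure_mono fun z hz hz1 => hz fun e _ hmax => ?_
  have hn : ∀ x : Param 1, ‖x‖ = |x 0| := fun x => by
    rw [EuclideanSpace.norm_eq]; simp [Real.sqrt_sq_eq_abs]
  have hi : ∀ x x' : Param 1, inner ℝ x x' = x 0 * x' 0 := fun x x' => by
    simp [PiLp.inner_apply, mul_comm]
  have key : ∀ i, ∀ h : Param 1, y (z i) * inner ℝ (z i) h = inner ℝ g h := by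
    intro i h
    have hz0 := hz1 i
    have hy := hyg (z i) (hz1 i) (by
      rw [hi, abs_mul, ← hn, ← hn, hg, hz0]; norm_num)
    rw [hn] at hg hz0
    rw [hy]
    simp only [hi]
    rcases (abs_eq one_pos.le).1 hg with e1 | e1 <;> rcases (abs_eq one_pos.le).1 hz0 with e2 | e2 <;>
      rw [e1, e2] <;> norm_num
  simp only [key, Finset.sum_const, Finset.card_univ, Fintype.card_fin, nsmul_eq_mul] at hmax
  have hm' : (0 : ℝ) < m := by positivity
  have := (mul_le_mul_iff_right₀ hm').1 hmax
  rw [real_inner_self_eq_norm_sq, hg] at this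
  linarith

/-! ### Running the scheme -/

lemma OracleComp.run_bind {Q A α β : Type*} (O : Q → A) (c : OracleComp Q A α)
    (f : α → OracleComp Q A β) :
    (c.bind f).run O = (((f (c.run O).1).run O).1, (c.run O).2 + ((f (c.run O).1).run O).2) := by
  induction c with
  | done a => simp [OracleComp.bind, OracleComp.run]
  | ask q k ih =>
    simp only [OracleComp.bind, OracleComp.run, ih]
    rw [add_right_comm]

lemma run_askAll {Q A : Type*} (O : Q → A) (m : ℕ) (q : Fin m → Q) :
    (askAll m q).run O = (fun i => O (q i), m) := by
  induction m with
  | zero => simp only [askAll, OracleComp.run]; congr 1; exact Subsingleton.elim _ _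
  | succ m ih =>
    simp only [askAll, OracleComp.run, OracleComp.run_bind, ih, add_zero]
    congr 1
    ext i
    refine Fin.cases ?_ (fun j => ?_) i <;> simp

/-- The orbit of `θ` under the update map `Φ` driven by the inputs `z`. -/
def orbit {α β : Type*} (Φ : α → β → α) : (T : ℕ) → α → (Fin T → β) → Fin (T + 1) → α
  | 0, θ, _ => fun _ => θ
  | T + 1, θ, z => Fin.cons θ (orbit Φ T (Φ θ (z 0)) fun t => z t.succ)

@[simp]
lemma orbit_zero {α β : Type*} (Φ : α → β → α) (T : ℕ) (θ : α) (z : Fin T → β) :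
    orbit Φ T θ z 0 = θ := by
  cases T <;> rfl

lemma orbit_succ {α β : Type*} (Φ : α → β → α) {T : ℕ} (θ : α) (z : Fin T → β) (t : Fin T) :
    orbit Φ T θ z t.succ = Φ (orbit Φ T θ z t.castSucc) (z t) := by
  induction T generalizing θ with
  | zero => exact t.elim0
  | succ T ih =>
    refine Fin.cases ?_ (fun j => ?_) t
    · simp [orbit]
    · rw [orbit, Fin.cons_succ, ih, ← Fin.succ_castSucc, Fin.cons_succ]

lemma measurable_orbit {α β : Type*} [MeasurableSpace α] [MeasurableSpace β] {Φ : α → β → α}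
    (hΦ : Measurable fun p : α × β => Φ p.1 p.2) (T : ℕ) (t : Fin (T + 1)) :
    Measurable fun p : α × (Fin T → β) => orbit Φ T p.1 p.2 t := by
  induction t using Fin.induction with
  | zero => simpa using measurable_fst
  | succ t ih =>
    simp only [orbit_succ]
    exact hΦ.comp (ih.prodMk (by fun_prop))

/-- Union bound along an orbit driven by independent inputs. -/
lemma measure_orbit_le {α β : Type*} [MeasurableSpace α] [MeasurableSpace β] {μ : Measure β}
    [IsProbabilityMeasure μ] {Φ : α → β → α} (hΦ : Measurable fun p : α × β => Φ p.1 p.2)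
    {B : Set (α × β)} (hB : MeasurableSet B) {q : ℝ≥0∞} (hq : ∀ θ, μ {b | (θ, b) ∈ B} ≤ q)
    (T : ℕ) (θ : α) :
    Measure.pi (fun _ : Fin T => μ) {z | ∃ t : Fin T, (orbit Φ T θ z t.castSucc, z t) ∈ B} ≤
      T * q := by
  induction T generalizing θ with
  | zero => simp
  | succ T ih =>
    have hθ : Measurable fun b : β => Φ θ b := hΦ.comp (by fun_prop : Measurable fun b => (θ, b))
    set S : Set (β × (Fin T → β)) :=
      {p | ∃ t : Fin T, (orbit Φ T (Φ θ p.1) p.2 t.castSucc, p.2 t) ∈ B} with hS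
    have hSm : MeasurableSet S := by
      have : S = ⋃ t : Fin T, {p | (orbit Φ T (Φ θ p.1) p.2 t.castSucc, p.2 t) ∈ B} := by
        ext p; simp [hS]
      rw [this]
      refine MeasurableSet.iUnion fun t => ?_
      have h1 : Measurable fun p : β × (Fin T → β) => orbit Φ T (Φ θ p.1) p.2 t.castSucc :=
        (measurable_orbit hΦ T t.castSucc).comp
          (by fun_prop : Measurable fun p : β × (Fin T → β) => (Φ θ p.1, p.2))
      exact (h1.prodMk (by fun_prop)) hB
    have hfirst : Measure.pi (fun _ : Fin (T + 1) => μ) {z | (θ, z 0) ∈ B} ≤ q := by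
      have hm : MeasurableSet {b | (θ, b) ∈ B} := (by fun_prop : Measurable fun b => (θ, b)) hB
      have := (measurePreserving_eval (fun _ : Fin (T + 1) => μ) 0).measure_preimage
        hm.nullMeasurableSet
      exact this.trans_le (hq θ)
    -- Given the first input, the remaining ones drive an orbit from a new starting point; the
    -- induction hypothesis is uniform in that point.
    have hrest : Measure.pi (fun _ : Fin (T + 1) => μ)
        ((MeasurableEquiv.piFinSuccAbove (fun _ => β) 0) ⁻¹' S) ≤ T * q := by
      rw [(measurePreserving_piFinSuccAbove (fun _ : Fin (T + 1) => μ) 0).measure_preimage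
        hSm.nullMeasurableSet, Measure.prod_apply hSm]
      calc _ ≤ ∫⁻ _ : β, T * q ∂μ := lintegral_mono fun b => ih (Φ θ b)
        _ = _ := by simp
    have hsub : {z | ∃ t : Fin (T + 1), (orbit Φ (T + 1) θ z t.castSucc, z t) ∈ B} ⊆
        {z | (θ, z 0) ∈ B} ∪ (MeasurableEquiv.piFinSuccAbove (fun _ => β) 0) ⁻¹' S := by
      rintro z ⟨t, ht⟩
      revert ht
      refine Fin.cases (fun ht => Or.inl ?_) (fun t ht => Or.inr ⟨t, ?_⟩) t
      · simpa using ht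
      · rw [← Fin.succ_castSucc, orbit, Fin.cons_succ] at ht
        exact ht
    calc _ ≤ _ := measure_mono hsub
      _ ≤ q + T * q := (measure_union_le _ _).trans (add_le_add hfirst hrest)
      _ = _ := by push_cast; ring

/-- The update made by one iteration, given the answers of the oracle `O`. -/
def update {m : ℕ} (O : Param d × Param d → ℝ) (r η : ℝ)
    (solver : (Fin m → Param d) → (Fin m → ℝ) → Param d) (θ : Param d) (z : Fin m → Param d) :
    Param d :=
  θ - η • solver z fun i => O (θ, θ + r • z i)

lemma run_basicScheme {m : ℕ} (O : Param d × Param d → ℝ) (r η : ℝ)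
    (solver : (Fin m → Param d) → (Fin m → ℝ) → Param d) (T : ℕ) (θ : Param d)
    (z : Fin T → Fin m → Param d) :
    (basicScheme r η solver T θ z).run O = (orbit (update O r η solver) T θ z, m * T) := by
  induction T generalizing θ with
  | zero => rfl
  | succ T ih =>
    simp only [basicScheme, OracleComp.run_bind, step, run_askAll, OracleComp.run, ih, orbit,
      update]
    congr 1
    ring

/-! ### Smooth functions -/

lemma IsSmoothWith.abs_sub_le {l : ℝ} {f : Param d → ℝ} (hf : IsSmoothWith l f) (θ v : Param d) :
    |f (θ + v) - f θ - inner ℝ (gradient f θ) v| ≤ l / 2 * ‖v‖ ^ 2 := by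
  set φ : ℝ → ℝ := fun t => f (θ + t • v) - f θ - t * inner ℝ (gradient f θ) v with hφ
  have hderiv : ∀ t, HasDerivAt φ
      (inner ℝ (gradient f (θ + t • v)) v - inner ℝ (gradient f θ) v) t := by
    intro t
    have h1 : HasDerivAt (fun t : ℝ => θ + t • v) v t := by
      simpa using ((hasDerivAt_id t).smul_const v).const_add θ
    have h2 := (hf.1 (θ + t • v)).hasGradientAt.hasFDerivAt.comp_hasDerivAt t h1
    have h3 := (h2.sub_const (f θ)).sub ((hasDerivAt_id t).mul_const (inner ℝ (gradient f θ) v))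
    convert! h3 using 1
    simp
  have h := image_norm_le_of_norm_deriv_right_le_deriv_boundary (f := φ) (a := 0) (b := 1)
    (B := fun t => l / 2 * ‖v‖ ^ 2 * t ^ 2) (B' := fun t => l * ‖v‖ ^ 2 * t)
    (fun t _ => (hderiv t).continuousAt.continuousWithinAt)
    (fun t _ => (hderiv t).hasDerivWithinAt) (by simp [hφ])
    (fun t => by
      have := ((hasDerivAt_id t).pow 2).const_mul (l / 2 * ‖v‖ ^ 2)
      convert! this using 1
      simp; ring)
    (fun t ht => by
      rw [← inner_sub_left]
      refine (norm_inner_le_norm _ _).trans ?_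
      have h4 := hf.2 (θ + t • v) θ
      rw [add_sub_cancel_left, norm_smul, Real.norm_of_nonneg ht.1] at h4
      calc _ ≤ l * (t * ‖v‖) * ‖v‖ := by gcongr
        _ = _ := by ring)
    (Set.right_mem_Icc.2 zero_le_one)
  simpa [hφ] using h

lemma IsSmoothWith.continuous_gradient {l : ℝ} {f : Param d → ℝ} (hf : IsSmoothWith l f) :
    Continuous (gradient f) := by
  have : LipschitzWith l.toNNReal (gradient f) := LipschitzWith.of_dist_le_mul fun x y => by
    rw [dist_eq_norm, dist_eq_norm]
    refine (hf.2 x y).trans ?_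
    gcongr
    exact Real.le_coe_toNNReal l
  exact this.continuous

/-- A gradient step of size `1/l` lowers `f` by at least `‖∇f‖²/(2l)`, which cannot exceed `Δ`. -/
lemma IsSmoothWith.norm_gradient_sq_le {l Δ : ℝ} {f : Param d → ℝ} (hf : IsSmoothWith l f)
    (hl : 0 < l) (hb : BddBelow (Set.range f)) {θ : Param d} (hΔ : f θ - ⨅ θ, f θ ≤ Δ) :
    ‖gradient f θ‖ ^ 2 ≤ 2 * (l * Δ) := by
  have h := (abs_le.1 (hf.abs_sub_le θ (-(l⁻¹ • gradient f θ)))).2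
  have h2 := ciInf_le hb (θ + -(l⁻¹ • gradient f θ))
  rw [inner_neg_right, real_inner_smul_right, real_inner_self_eq_norm_sq, norm_neg, norm_smul,
    Real.norm_of_nonneg (by positivity), mul_pow] at h
  have e : l / 2 * (l⁻¹ ^ 2 * ‖gradient f θ‖ ^ 2) = l⁻¹ * ‖gradient f θ‖ ^ 2 / 2 := by
    field_simp
  rw [e] at h
  have h3 : l⁻¹ * ‖gradient f θ‖ ^ 2 ≤ 2 * Δ := by linarith
  rw [inv_mul_le_iff₀ hl] at h3
  linarith

/-- The Taylor remainder is at most `l r²/2 = r ε/(80√d)`, and off the strip the linear term `r ‖∇f‖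
|⟨g, z⟩|` exceeds it. -/
lemma IsSmoothWith.agreesOffStrip (hd : 0 < d) {l ε r : ℝ} {f : Param d → ℝ}
    (hf : IsSmoothWith l f) (hl : 0 < l) (hε : 0 < ε) (hr : r = ε / (40 * l * √d)) {θ : Param d}
    (hθ : ε ≤ ‖gradient f θ‖) :
    AgreesOffStrip (‖gradient f θ‖⁻¹ • gradient f θ)
      fun z => if f (θ + r • z) < f θ then -1 else 1 := by
  intro z hz hstrip
  have hs : 0 < √(d : ℝ) := by positivity
  have hr0 : 0 < r := by rw [hr]; positivity
  set G := ‖gradient f θ‖ with hG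
  have hG0 : 0 < G := hε.trans_le hθ
  set X := inner ℝ (G⁻¹ • gradient f θ) z with hX
  have hin : inner ℝ (gradient f θ) (r • z) = r * (G * X) := by
    rw [hX, real_inner_smul_right, real_inner_smul_left]; field_simp
  have h := hf.abs_sub_le θ (r • z)
  rw [hin, norm_smul, hz, mul_one, Real.norm_of_nonneg hr0.le] at h
  have hb : l / 2 * r ^ 2 < r * (G * |X|) := by
    calc l / 2 * r ^ 2 = r * (ε * (1 / (80 * √d))) := by
          rw [pow_two, ← mul_assoc, mul_comm, hr]; field_simp; norm_num
      _ ≤ r * (G * (1 / (80 * √d))) := by gcongr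
      _ < _ := by gcongr
  have h1 := abs_le.1 h
  simp only
  rcases le_or_gt 0 X with hX0 | hX0
  · rw [abs_of_nonneg hX0] at hb
    rw [if_neg (by linarith), if_pos hX0]
  · rw [abs_of_neg hX0] at hb
    rw [if_pos (by linarith), if_neg (by linarith)]

lemma IsSmoothWith.le_sub_of_correlated {l η ε : ℝ} {f : Param d → ℝ} (hf : IsSmoothWith l f)
    (hl : 0 < l) (hη : 0 ≤ η) {T : ℕ} {θs : Fin (T + 1) → Param d}
    (h : ∀ t : Fin T, ε ≤ ‖gradient f (θs t.castSucc)‖ ∧ ∃ e : Param d, ‖e‖ ≤ 1 ∧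
      θs t.succ = θs t.castSucc - η • e ∧
      ‖gradient f (θs t.castSucc)‖ / 2 ≤ inner ℝ (gradient f (θs t.castSucc)) e)
    (t : Fin (T + 1)) :
    f (θs t) ≤ f (θs 0) - t * (η * ε / 2 - l * η ^ 2 / 2) := by
  induction t using Fin.induction with
  | zero => simp
  | succ t ih =>
    obtain ⟨hε, e, he, hs, hc⟩ := h t
    have h1 := (abs_le.1 (hf.abs_sub_le (θs t.castSucc) (-(η • e)))).2
    rw [← sub_eq_add_neg, ← hs, inner_neg_right, real_inner_smul_right, norm_neg, norm_smul,
      Real.norm_of_nonneg hη, mul_pow] at h1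
    have h2 : l / 2 * (η ^ 2 * ‖e‖ ^ 2) ≤ l / 2 * (η ^ 2 * 1) := by
      have : ‖e‖ ^ 2 ≤ 1 := by nlinarith [norm_nonneg e]
      gcongr
    have h3 : η * (ε / 2) ≤ η * inner ℝ (gradient f (θs t.castSucc)) e := by
      gcongr; linarith
    simp only [Fin.val_castSucc] at ih
    rw [Fin.val_succ]
    push_cast
    linarith

/-- Otherwise summing the descent inequality gives `T η ε ≤ 4Δ`, since the quadratic terms add up to
exactly `Δ`. But `(T η ε)² = 2Δ T ε²/l ≥ 20 Δ²`, and `20 > 16`. -/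
lemma IsSmoothWith.exists_norm_gradient_lt {l ε Δ η : ℝ} {f : Param d → ℝ} (hf : IsSmoothWith l f)
    (hl : 0 < l) (hε : 0 < ε) (hΔ : 0 < Δ) (hb : BddBelow (Set.range f)) {T : ℕ} (hT0 : 0 < T)
    (hT : 10 * (l * Δ / ε ^ 2) ≤ T) (hη : η = √(2 * Δ / (l * T))) {θs : Fin (T + 1) → Param d}
    (hθ : f (θs 0) - ⨅ θ, f θ ≤ Δ)
    (h : ∀ t : Fin T, ε ≤ ‖gradient f (θs t.castSucc)‖ → ∃ e : Param d, ‖e‖ ≤ 1 ∧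
      θs t.succ = θs t.castSucc - η • e ∧
      ‖gradient f (θs t.castSucc)‖ / 2 ≤ inner ℝ (gradient f (θs t.castSucc)) e) :
    ∃ t : Fin T, ‖gradient f (θs t.castSucc)‖ < ε := by
  by_contra! hge
  have hT' : (0 : ℝ) < T := by positivity
  have hη0 : 0 ≤ η := hη ▸ Real.sqrt_nonneg _
  have h1 := hf.le_sub_of_correlated hl hη0 (fun t => ⟨hge t, h t (hge t)⟩) (Fin.last T)
  have h2 := ciInf_le hb (θs (Fin.last T))
  rw [Fin.val_last] at h1
  have hη2 : η ^ 2 = 2 * Δ / (l * T) := by rw [hη, Real.sq_sqrt (by positivity)]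
  have h3 : T * (l * η ^ 2 / 2) = Δ := by rw [hη2]; field_simp
  have h4 : T * η * ε ≤ 4 * Δ := by linarith
  have h5 : (T * η * ε) ^ 2 = 2 * Δ / l * (T * ε ^ 2) := by
    rw [mul_pow, mul_pow, hη2]; field_simp
  have h6 : 10 * (l * Δ) ≤ T * ε ^ 2 := by
    rwa [← mul_div_assoc, div_le_iff₀ (by positivity)] at hT
  have h7 : 20 * Δ ^ 2 ≤ (T * η * ε) ^ 2 := by
    rw [h5]
    calc 20 * Δ ^ 2 = 2 * Δ / l * (10 * (l * Δ)) := by field_simp; norm_num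
      _ ≤ _ := by gcongr
  have h8 : 0 ≤ T * η * ε := by positivity
  nlinarith

/-! ### Sample sizes -/

lemma mul_log_two_le {s : ℝ} (hs1 : 1 ≤ s) (hsd : s ≤ d) :
    s * Real.log 2 ≤ s * Real.log (2 * d / s) := by
  have hs0 : 0 < s := by linarith
  gcongr
  rw [le_div_iff₀ hs0]
  linarith

/-- A constant strictly above `log 2` is needed: `log(x/Λ)` may come close to `-log 2`, and the
sample size must stay bounded away from zero. -/
lemma le_mul_log {s : ℝ} (hd : 2 ≤ d) (hs1 : 1 ≤ s) (hsd : s ≤ d) :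
    1.4 * Real.log 2 ≤ s * Real.log (2 * d / s) := by
  have hs0 : 0 < s := by linarith
  have hl2 : 0 < Real.log 2 := Real.log_pos (by norm_num)
  rcases le_total s 1.4 with h | h
  · have h1 : 7 * Real.log 2 ≤ 5 * Real.log (20 / 7) := by
      have : Real.log (2 ^ 7) ≤ Real.log ((20 / 7) ^ 5) := by
        apply Real.log_le_log <;> norm_num
      rw [Real.log_pow, Real.log_pow] at this
      exact_mod_cast this
    have h2 : Real.log (20 / 7) ≤ Real.log (2 * d / s) := by
      apply Real.log_le_log (by norm_num)
      rw [div_le_div_iff₀ (by norm_num) hs0]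
      have : (2 : ℝ) ≤ d := by exact_mod_cast hd
      norm_num at h
      linarith
    nlinarith
  · exact le_trans (by gcongr) (mul_log_two_le hs1 hsd)

/-- The left sides are at most `2.1 A + 5 log 2 + log(x/Λ)` and `A`. The factor `24` lets `A ≥ 1.4
log 2` absorb both the constant and a negative `log(x/Λ) ≥ -log 2`. -/
lemma sample_size_bounds {s x Λ : ℝ} (hd : 2 ≤ d) (hs1 : 1 ≤ s) (hsd : s ≤ d) (hx : 1 / 2 ≤ x)
    (hΛ : 0 < Λ) (hΛ1 : Λ < 1) {T : ℕ} (hT0 : 0 < T) (hT : (T : ℝ) ≤ 10 * x + 1) :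
    √2 * s + Real.log (1 / (Λ / (2 * T))) ≤
      24 * (s * Real.log (2 * d / s) + Real.log (x / Λ)) ∧
    s * Real.log (d / s) ≤ 24 * (s * Real.log (2 * d / s) + Real.log (x / Λ)) := by
  have hs0 : 0 < s := by linarith
  have hT' : (0 : ℝ) < T := by positivity
  have hx0 : 0 < x := by linarith
  set A := s * Real.log (2 * d / s) with hA
  have hl2 := Real.log_two_gt_d9
  have hA1 := le_mul_log hd hs1 hsd
  have hA2 := mul_log_two_le hs1 hsd
  rw [← hA] at hA1 hA2
  have hb : -Real.log 2 ≤ Real.log (x / Λ) := by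
    rw [← Real.log_inv]
    apply Real.log_le_log (by norm_num)
    rw [le_div_iff₀ hΛ]
    norm_num at *
    linarith
  constructor
  · have h1 : Real.log (1 / (Λ / (2 * T))) ≤ 5 * Real.log 2 + Real.log (x / Λ) := by
      have e : 5 * Real.log 2 = Real.log 32 := by
        rw [show (32 : ℝ) = 2 ^ 5 by norm_num, Real.log_pow]; norm_num
      rw [e, ← Real.log_mul (by norm_num) (by positivity)]
      apply Real.log_le_log (by positivity)
      rw [one_div_div, ← mul_div_assoc]
      refine div_le_div_of_nonneg_right ?_ hΛ.le
      linarith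
    have h2 : √2 ≤ 1.42 := by rw [Real.sqrt_le_left (by norm_num)]; norm_num
    have h3 : √2 * s ≤ 2.1 * A := by
      calc √2 * s ≤ 1.42 * s := by gcongr
        _ ≤ 2.1 * (s * Real.log 2) := by nlinarith
        _ ≤ _ := by gcongr
    linarith
  · have h1 : s * Real.log (d / s) ≤ A := by
      rw [hA]
      have hd' : (0 : ℝ) < d := by linarith
      gcongr
      linarith
    linarith

lemma oracle_calls_le {s x Λ c : ℝ} (hs1 : 1 ≤ s) (hsd : s ≤ d) (hx : 1 ≤ x)
    (hΛ : 0 < Λ) (hΛ1 : Λ < 1) (hc : 0 < c) {T m : ℕ} (hT : (T : ℝ) ≤ 10 * x + 1)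
    (hm : m = max 1 ⌈c * (s * Real.log (2 * d / s) + Real.log (x / Λ))⌉₊) :
    ((m * T : ℕ) : ℝ) ≤ 11 * (c + 2) * (x * (s * Real.log (2 * d / s) + Real.log (x / Λ))) := by
  set L := s * Real.log (2 * d / s) + Real.log (x / Λ) with hL
  have hl2 := Real.log_two_gt_d9
  have h1 : 0 ≤ Real.log (x / Λ) := Real.log_nonneg (by rw [le_div_iff₀ hΛ]; linarith)
  have h2 := mul_log_two_le hs1 hsd
  -- This absorbs the `max` with `1` and the rounding: `1 ≤ 2L`.
  have hL2 : 1 / 2 ≤ L := by nlinarith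
  have hm2 : (m : ℝ) ≤ (c + 2) * L := by
    rw [hm, Nat.cast_max, max_le_iff]
    have hcL : 0 ≤ c * L := by positivity
    exact ⟨by push_cast; linarith, (Nat.ceil_lt_add_one hcL).le.trans (by linarith)⟩
  push_cast
  calc (m : ℝ) * T ≤ (c + 2) * L * (11 * x) := by
        gcongr
        linarith
    _ = _ := by ring

/-! ### The convergence guarantee -/

lemma map_eq_pi_of_iIndepFun {Ω α : Type*} [MeasurableSpace Ω] [MeasurableSpace α] {P : Measure Ω}
    [IsProbabilityMeasure P] {T m : ℕ} {Z : Fin T → Fin m → Ω → α} {μ : Measure α}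
    [IsProbabilityMeasure μ] (hZ : ∀ t i, Measurable (Z t i)) (hμ : ∀ t i, P.map (Z t i) = μ)
    (hind : iIndepFun (fun ti : Fin T × Fin m => Z ti.1 ti.2) P) :
    P.map (fun ω t i => Z t i ω) = Measure.pi fun _ : Fin T => Measure.pi fun _ : Fin m => μ := by
  have h := (iIndepFun_iff_map_fun_eq_pi_map (fun ti : Fin T × Fin m => (hZ ti.1 ti.2).aemeasurable)).1 hind
  simp only [hμ] at h
  have h2 := Measure.infinitePi_map_curry (ι := Fin T) (κ := Fin m) (X := α) (fun _ _ => μ)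
  simp only [Measure.infinitePi_eq_pi] at h2
  rw [← h2, ← h, Measure.map_map (by fun_prop) (by fun_prop)]
  rfl

/-- The event that an iteration from a point with large gradient produces a direction that is
poorly correlated with the gradient. -/
def badStep {m : ℕ} (f : Param d → ℝ) (ε r : ℝ)
    (solver : (Fin m → Param d) → (Fin m → ℝ) → Param d) : Set (Param d × (Fin m → Param d)) :=
  {p | ε ≤ ‖gradient f p.1‖ ∧ ¬ ‖gradient f p.1‖ / 2 ≤ inner ℝ (gradient f p.1)
    (solver p.2 fun i => if f (p.1 + r • p.2 i) < f p.1 then -1 else 1)}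

lemma measurable_answers {m : ℕ} {f : Param d → ℝ} (hf : Continuous f) (r : ℝ) :
    Measurable fun p : Param d × (Fin m → Param d) =>
      fun i => if f (p.1 + r • p.2 i) < f p.1 then (-1 : ℝ) else 1 :=
  measurable_pi_lambda _ fun i => Measurable.ite
    (measurableSet_lt (hf.measurable.comp (by fun_prop)) (hf.measurable.comp (by fun_prop)))
    measurable_const measurable_const

lemma measurableSet_badStep {m : ℕ} {f : Param d → ℝ} (hf : Continuous f)
    (hg : Continuous (gradient f)) (ε r : ℝ)
    {solver : (Fin m → Param d) → (Fin m → ℝ) → Param d}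
    (hsolver : Measurable (Function.uncurry solver)) :
    MeasurableSet (badStep f ε r solver) := by
  have h1 : Measurable fun p : Param d × (Fin m → Param d) => gradient f p.1 :=
    hg.measurable.comp measurable_fst
  have h2 : Measurable fun p : Param d × (Fin m → Param d) =>
      solver p.2 fun i => if f (p.1 + r • p.2 i) < f p.1 then (-1 : ℝ) else 1 :=
    hsolver.comp (measurable_snd.prodMk (measurable_answers hf r))
  exact (measurableSet_le measurable_const h1.norm).inter
    (measurableSet_le (h1.norm.div_const 2) (h1.inner h2)).compl

lemma measure_badStep_le (hd : 0 < d) {m : ℕ} (hm : 0 < m) {s l ε r q : ℝ} (hs1 : 1 ≤ s)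
    (hsd : s ≤ d) {f : Param d → ℝ} (hl : 0 < l) (hε : 0 < ε) (hf : IsSmoothWith l f)
    (hsparse : ∀ θ, l1Norm (gradient f θ) ≤ √s * ‖gradient f θ‖) (hr : r = ε / (40 * l * √d))
    {solver : (Fin m → Param d) → (Fin m → ℝ) → Param d} (hsolver : IsArgmaxSolver s solver)
    (hq : 0 < q)
    (hm1 : 2 ≤ d → 102400 * (√2 * s + Real.log (1 / q)) ≤ m)
    (hm2 : 2 ≤ d → 102400 * (s * Real.log (d / s)) ≤ m) (θ : Param d) :
    Measure.pi (fun _ : Fin m => uniformSphere d) {z | (θ, z) ∈ badStep f ε r solver} ≤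
      ENNReal.ofReal q := by
  by_cases hθ : ε ≤ ‖gradient f θ‖
  swap
  · simp [badStep, hθ]
  set G := ‖gradient f θ‖ with hG
  have hG0 : 0 < G := hε.trans_le hθ
  set g := G⁻¹ • gradient f θ with hg
  have hg1 : ‖g‖ = 1 := by
    rw [hg, norm_smul, norm_inv, Real.norm_of_nonneg hG0.le, ← hG, inv_mul_cancel₀ hG0.ne']
  have hgs : l1Norm g ≤ √s := by
    have : l1Norm g = G⁻¹ * l1Norm (gradient f θ) := by
      simp [hg, l1Norm, abs_mul, Finset.mul_sum, abs_of_pos hG0]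
    rw [this, inv_mul_le_iff₀ hG0, mul_comm]
    exact hsparse θ
  set y : Param d → ℝ := fun z => if f (θ + r • z) < f θ then -1 else 1 with hy
  have hym : Measurable y := Measurable.ite
    (measurableSet_lt (hf.1.continuous.measurable.comp (by fun_prop)) measurable_const)
    measurable_const measurable_const
  have hys : IsSignValued y := fun z => by by_cases h : f (θ + r • z) < f θ <;> simp [hy, h]
  have hyg : AgreesOffStrip g y := hf.agreesOffStrip hd hl hε hr hθ
  have hsub : {z : Fin m → Param d | (θ, z) ∈ badStep f ε r solver} ⊆
      {z | ¬ ∀ e ∈ feasible d s, ∑ i, y (z i) * inner ℝ (z i) g ≤ ∑ i, y (z i) * inner ℝ (z i) e →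
          1 / 2 ≤ inner ℝ g e} := by
    rintro z ⟨-, hz⟩ hall
    obtain ⟨h1, h2⟩ := hsolver z fun i => y (z i)
    have h3 := hall _ h1 (h2 ⟨hgs, hg1.le⟩)
    refine hz ?_
    rw [hg, real_inner_smul_left, ← div_eq_inv_mul, le_div_iff₀ hG0] at h3
    change G / 2 ≤ inner ℝ (gradient f θ) (solver z fun i => y (z i))
    linarith
  refine (measure_mono hsub).trans ?_
  rcases Nat.lt_or_ge d 2 with h | h
  · obtain rfl : d = 1 := by omega
    rw [measure_not_correlated_of_dim_one hm hg1 hyg]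
    exact zero_le
  · exact measure_not_correlated_le hd hm hs1 hsd hg1 hgs hym hys hyg hq (hm1 h) (hm2 h)

end ComPO

theorem theorem1 :
    ∃ c_m C : ℝ, 0 < c_m ∧ 0 < C ∧
      ∀ (d : ℕ) (s : ℝ), 1 ≤ s → s ≤ d →
      ∀ (V : Type*) (p : ComPO.Policy d V) (D : Set (ComPO.PrefSample V))
        (f : ComPO.Param d → ℝ) (l : ℝ), 0 < l → ComPO.IsSmoothWith l f →
        (∀ θ θ' : ComPO.Param d, f θ' < f θ ↔ ComPO.Improves p D θ θ') →
        (∀ θ : ComPO.Param d, ComPO.l1Norm (gradient f θ) ≤ √s * ‖gradient f θ‖) →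
      ∀ (θ₁ : ComPO.Param d) (Δ : ℝ), 0 < Δ →
        BddBelow (Set.range f) → f θ₁ - ⨅ θ, f θ ≤ Δ →
      ∀ ε Λ : ℝ, 0 < ε → ε < 1 → 0 < Λ → Λ < 1 →
      ∃ T : ℕ, 0 < T ∧ T = ⌈10 * (l * Δ / ε ^ 2)⌉₊ ∧
        ∀ (η r : ℝ) (m : ℕ),
          η = √(2 * Δ / (l * T)) →
          r = ε / (40 * l * √d) →
          m = max 1 ⌈c_m * (s * Real.log (2 * d / s) + Real.log (l * Δ / (Λ * ε ^ 2)))⌉₊ →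
        ∀ (solver : (Fin m → ComPO.Param d) → (Fin m → ℝ) → ComPO.Param d),
          ComPO.IsArgmaxSolver s solver → Measurable (Function.uncurry solver) →
        ∀ (Ω : Type*) [MeasurableSpace Ω] (P : Measure Ω) [IsProbabilityMeasure P]
          (Z : Fin T → Fin m → Ω → ComPO.Param d),
          (∀ t i, Measurable (Z t i)) →
          (∀ t i, P.map (Z t i) = ComPO.uniformSphere d) →
          iIndepFun (fun ti : Fin T × Fin m => Z ti.1 ti.2) P →
        ∀ out : Ω → (Fin (T + 1) → ComPO.Param d) × ℕ,
          (∀ ω, out ω = (ComPO.basicScheme r η solver T θ₁ fun t i => Z t i ω).run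
            (ComPO.prefOracle p D)) →
        1 - Λ < P.real {ω | ⨅ t : Fin T, ‖gradient f ((out ω).1 t.castSucc)‖ < ε} ∧
        (∀ ω, (out ω).2 = m * T) ∧
        (ε ^ 2 ≤ l * Δ → ∀ ω, ((out ω).2 : ℝ) ≤
          C * (l * Δ / ε ^ 2 *
            (s * Real.log (2 * d / s) + Real.log (l * Δ / (Λ * ε ^ 2))))) := by
  refine ⟨102400 * 24, 11 * (102400 * 24 + 2), by norm_num, by norm_num, ?_⟩
  intro d s hs1 hsd V p D f l hl hf hfp hsparse θ₁ Δ hΔ hbdd hθ₁ ε Λ hε hε1 hΛ hΛ1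
  have hd : 0 < d := by
    have : (0 : ℝ) < d := by linarith
    exact_mod_cast this
  set x : ℝ := l * Δ / ε ^ 2 with hx
  have hx0 : 0 < x := by positivity
  have hxΛ : l * Δ / (Λ * ε ^ 2) = x / Λ := by rw [hx]; field_simp
  rw [hxΛ]
  have hT0 : 0 < ⌈10 * x⌉₊ := Nat.ceil_pos.2 (by positivity)
  refine ⟨⌈10 * x⌉₊, hT0, rfl, ?_⟩
  have hTle : 10 * x ≤ (⌈10 * x⌉₊ : ℝ) := Nat.le_ceil _
  have hTlt : (⌈10 * x⌉₊ : ℝ) ≤ 10 * x + 1 := (Nat.ceil_lt_add_one (by positivity)).le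
  generalize ⌈10 * x⌉₊ = T at *
  intro η r m hη hr hm solver hsolver hsm Ω _ P _ Z hZ hμ hind out hout
  have hm0 : 0 < m := by rw [hm]; exact lt_of_lt_of_le one_pos (le_max_left _ _)
  set Φ := ComPO.update (ComPO.prefOracle p D) r η solver with hΦ
  have hrun : ∀ ω, out ω = (ComPO.orbit Φ T θ₁ fun t i => Z t i ω, m * T) := fun ω => by
    rw [hout, ComPO.run_basicScheme]
  have horacle : ∀ θ θ', ComPO.prefOracle p D (θ, θ') = if f θ' < f θ then -1 else 1 :=
    fun θ θ' => by
    by_cases h : f θ' < f θ <;> simp [ComPO.prefOracle, ← hfp, h]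
  refine ⟨?_, fun ω => by rw [hrun], fun hle ω => ?_⟩
  swap
  · rw [hrun]
    have hx1 : 1 ≤ x := by rw [hx, le_div_iff₀ (by positivity)]; linarith
    exact ComPO.oracle_calls_le hs1 hsd hx1 hΛ hΛ1 (by norm_num) hTlt hm
  have hT' : (0 : ℝ) < T := by exact_mod_cast hT0
  have hinf : ∀ ω, (∃ t : Fin T, ‖gradient f ((out ω).1 t.castSucc)‖ < ε) →
      ⨅ t : Fin T, ‖gradient f ((out ω).1 t.castSucc)‖ < ε := fun ω ⟨t, ht⟩ =>
    (ciInf_le ⟨0, by rintro _ ⟨t, rfl⟩; exact norm_nonneg _⟩ t).trans_lt ht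
  -- For `x < 1/2` the prescribed `m` may be too small, but then `‖∇f(θ₁)‖² ≤ 2lΔ < ε²` and the
  -- starting point already qualifies.
  rcases lt_or_ge x (1 / 2) with hx2 | hx2
  · have hall : {ω | ⨅ t : Fin T, ‖gradient f ((out ω).1 t.castSucc)‖ < ε} = Set.univ := by
      refine Set.eq_univ_of_forall fun ω => hinf ω ⟨⟨0, hT0⟩, ?_⟩
      rw [hrun]
      have h0 : (⟨0, hT0⟩ : Fin T).castSucc = 0 := rfl
      simp only [h0, ComPO.orbit_zero]
      have h1 := hf.norm_gradient_sq_le hl hbdd hθ₁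
      rw [hx, div_lt_iff₀ (by positivity)] at hx2
      exact lt_of_pow_lt_pow_left₀ 2 hε.le (by linarith)
    rw [hall, probReal_univ]
    linarith
  -- The total failure probability becomes `Λ/2`, which yields the strict inequality.
  set q : ℝ := Λ / (2 * T) with hq
  have hq0 : 0 < q := by positivity
  have hsize : 2 ≤ d → 102400 * (√2 * s + Real.log (1 / q)) ≤ m ∧
      102400 * (s * Real.log (d / s)) ≤ m := by
    intro hd2
    obtain ⟨h1, h2⟩ := ComPO.sample_size_bounds hd2 hs1 hsd hx2 hΛ hΛ1 hT0 hTlt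
    have h3 : 102400 * 24 * (s * Real.log (2 * d / s) + Real.log (x / Λ)) ≤ m := by
      rw [hm, Nat.cast_max]
      exact (Nat.le_ceil _).trans (le_max_right _ _)
    rw [← hq] at h1
    constructor <;> linarith
  have hPμ := ComPO.isProbabilityMeasure_uniformSphere hd
  have hΦm : Measurable fun p : ComPO.Param d × (Fin m → ComPO.Param d) => Φ p.1 p.2 := by
    have h1 : Measurable fun p : ComPO.Param d × (Fin m → ComPO.Param d) =>
        solver p.2 fun i => if f (p.1 + r • p.2 i) < f p.1 then (-1 : ℝ) else 1 :=
      hsm.comp (measurable_snd.prodMk (ComPO.measurable_answers hf.1.continuous r))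
    simp only [hΦ, ComPO.update, horacle]
    exact measurable_fst.sub (h1.const_smul η)
  have hBm := ComPO.measurableSet_badStep hf.1.continuous hf.continuous_gradient ε r hsm
  have hbound := ComPO.measure_orbit_le hΦm hBm
    (ComPO.measure_badStep_le hd hm0 hs1 hsd hl hε hf hsparse hr hsolver hq0
      (fun h => (hsize h).1) (fun h => (hsize h).2)) T θ₁
  rw [← ComPO.map_eq_pi_of_iIndepFun hZ hμ hind] at hbound
  have hbad : P {ω | ⨅ t : Fin T, ‖gradient f ((out ω).1 t.castSucc)‖ < ε}ᶜ ≤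
      ENNReal.ofReal (Λ / 2) := by
    have hTq : T * ENNReal.ofReal q = ENNReal.ofReal (Λ / 2) := by
      rw [← ENNReal.ofReal_natCast, ← ENNReal.ofReal_mul hT'.le, hq]
      congr 1; field_simp
    rw [hTq] at hbound
    refine le_trans (le_trans (measure_mono ?_) (Measure.le_map_apply (by fun_prop) _)) hbound
    intro ω hω
    by_contra hgood
    refine hω (hinf ω ?_)
    rw [hrun]
    refine hf.exists_norm_gradient_lt hl hε hΔ hbdd hT0 hTle hη
      (by simpa only [ComPO.orbit_zero] using hθ₁) fun t ht => ?_
    set θ := ComPO.orbit Φ T θ₁ (fun t i => Z t i ω) t.castSucc with hθ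
    refine ⟨solver (fun i => Z t i ω) fun i => ComPO.prefOracle p D (θ, θ + r • Z t i ω),
      (hsolver _ _).1.2, ComPO.orbit_succ _ _ _ _, ?_⟩
    by_contra hcorr
    refine hgood ⟨t, ht, ?_⟩
    simp only [horacle] at hcorr
    exact hcorr
  -- Subadditivity suffices here, so measurability of the event need not be shown.
  have hcompl : 1 ≤ P.real {ω | ⨅ t : Fin T, ‖gradient f ((out ω).1 t.castSucc)‖ < ε} +
      P.real {ω | ⨅ t : Fin T, ‖gradient f ((out ω).1 t.castSucc)‖ < ε}ᶜ := by
    rw [← probReal_univ (μ := P), ← Set.union_compl_self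
      {ω | ⨅ t : Fin T, ‖gradient f ((out ω).1 t.castSucc)‖ < ε}]
    exact measureReal_union_le _ _
  have hreal := ENNReal.toReal_le_of_le_ofReal (by positivity) hbad
  change P.real _ ≤ _ at hreal
  linarith
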